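/- **Definitions.** All scalars are real. A function $S:[1,\infty)\to\mathbb R$ is called *submultiplicative* if it is piecewise linear (with finitely many breakpoints in each bounded interval), continuous, strictly increasing and concave, $S(x)=x$ for $1\le x\le 2$, and $S(xy)\le S(x)S(y)$ for all $x,y\ge 1$. A sequence $(S_i)_{i\ge1}$ of submultiplicative functions is called *incomparable* if for every nonempty finite $A\subset\mathbb N$ and every $j\in\mathbb N\setminus A$ $$\sup_{n\ge1}\frac{S_j(n)}{\max_{i\in A}S_i(n)}=\infty .$$ For such a sequence put $w_i(1)=S_i(1)=1$ and $w_i(n)=S_i(n)-S_i(n-1)$ for $n\ge2$; each $w_i$ is a positive non-increasing sequence with $w_i(n)\to0$ and $\sum_n w_i(n)=\infty$. The Lorentz space $d(w,1)$ consists of the real null sequences $a$ with $\|a\|_{w,1}=\sum_n a^*_n w(n)<\infty$, where $(a^*_n)$ is the non-increasing rearrangement of $(|a_n|)$. Let $X_n(1)=\big(\bigoplus_{i=1}^n d(w_i,1)\big)_\infty$, the direct sum with the maximum norm. A normalized basic sequence $(x_i)$ in a Banach space $X$ *generates the spreading model* $(\tilde x_i)$ if there are $\varepsilon_n\downarrow0$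 such that $$(1+\varepsilon_n)^{-1}\Big\|\sum_{i=1}^n a_i\tilde x_i\Big\|\le\Big\|\sum_{i=1}^n a_i x_{k_i}\Big\|\le(1+\varepsilon_n)\Big\|\sum_{i=1}^n a_i\tilde x_i\Big\|$$ for all $n$, all $a_1,\dots,a_n\in[-1,1]$ and all $n\le k_1<\dots<k_n$. A sequence $(\tilde y_i)$ *dominates* $(\tilde x_i)$, written $(\tilde x_i)\le(\tilde y_i)$, if for some $C<\infty$ one has $\|\sum a_i\tilde x_i\|\le C\|\sum a_i\tilde y_i\|$ for all finitely supported $(a_i)$; two sequences are *equivalent* if each dominates the other. $SP_w(X)$ is the set of equivalence classes of spreading models of $X$ generated by weakly null normalized basic sequences, partially ordered by domination. **Theorem.** Incomparable sequences $(S_i)_{i\ge1}$ of submultiplicative functions exist, and for every such sequence and every $n\in\mathbb N$ the partially ordered set $SP_w(X_n(1))$ is order-isomorphic to $P(n)\setminus\{\emptyset\}$, the set of nonempty subsets of $\{1,\dots,n\}$ ordered by inclusion. -/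

import Mathlib

open Filter Topology

noncomputable section

/-! ### Submultiplicative functions -/

/-- `S` is piecewise linear on `[1, ∞)`: there are breakpoints `1 = t 0 < t 1 < t 2 < ⋯ → ∞` such
that `S` is affine on every `[t k, t (k + 1)]`. -/
def IsPiecewiseLinear (S : ℝ → ℝ) : Prop :=
  ∃ t : ℕ → ℝ, StrictMono t ∧ t 0 = 1 ∧ Tendsto t atTop atTop ∧
    ∀ k, ∃ α β : ℝ, ∀ x ∈ Set.Icc (t k) (t (k + 1)), S x = α * x + β

/-- `S` is submultiplicative on `[1, ∞)`. Only the values of `S` on `[1, ∞)` matter. -/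
structure IsSubmultiplicative (S : ℝ → ℝ) : Prop where
  piecewiseLinear : IsPiecewiseLinear S
  continuousOn : ContinuousOn S (Set.Ici 1)
  strictMonoOn : StrictMonoOn S (Set.Ici 1)
  concaveOn : ConcaveOn ℝ (Set.Ici 1) S
  eq_self : ∀ x ∈ Set.Icc (1 : ℝ) 2, S x = x
  map_mul_le : ∀ x y : ℝ, 1 ≤ x → 1 ≤ y → S (x * y) ≤ S x * S y

/-- A sequence of submultiplicative functions on `[1, ∞)` such that
`sup_{n ≥ 1} S_j(n) / max_{i ∈ A} S_i(n) = ∞` for all nonempty finite `A` and all `j ∉ A`. -/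
structure IsIncomparableFamily (S : ℕ → ℝ → ℝ) : Prop where
  submultiplicative : ∀ i, IsSubmultiplicative (S i)
  incomparable : ∀ (A : Finset ℕ) (hA : A.Nonempty) (j : ℕ), j ∉ A →
    ∀ M : ℝ, ∃ n : ℕ, 1 ≤ n ∧ M < S j n / A.sup' hA (fun i => S i n)

/-! ### Weights -/

/-- A weight sequence: non-increasing, positive, `w(1) = 1`, `w(n) → 0`, `∑ w(n) = ∞`.
Sequences are indexed from `0`, so `w k` is the term usually called `w(k + 1)`. -/
structure LorentzWeight where
  toFun : ℕ → ℝ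
  pos : ∀ k, 0 < toFun k
  antitone : Antitone toFun
  map_zero : toFun 0 = 1
  tendsto_zero : Tendsto toFun atTop (𝓝 0)
  not_summable : ¬ Summable toFun

/-- The sequence `w(n) = S(n) - S(n - 1)` (`n ≥ 1`, with `S(0)` read as `0`), whose fundamental
function is `S`; it is indexed from `0`. -/
def weightSeq (S : ℝ → ℝ) : ℕ → ℝ
  | 0 => S 1
  | k + 1 => S ((k : ℝ) + 2) - S ((k : ℝ) + 1)

theorem sum_weightSeq (S : ℝ → ℝ) (m : ℕ) :
    ∑ k ∈ Finset.range (m + 1), weightSeq S k = S ((m : ℝ) + 1) := by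
  induction m with
  | zero => simp [weightSeq]
  | succ m ih =>
    rw [Finset.sum_range_succ, ih]
    simp only [weightSeq]
    push_cast
    have : (m : ℝ) + 1 + 1 = m + 2 := by ring
    rw [this]; ring

namespace IsSubmultiplicative

variable {S : ℝ → ℝ}

theorem weightSeq_pos (h : IsSubmultiplicative S) (k : ℕ) : 0 < weightSeq S k := by
  cases k with
  | zero => simp [weightSeq, h.eq_self 1 (by norm_num)]
  | succ k =>
    have hk : (0 : ℝ) ≤ k := k.cast_nonneg
    have := h.strictMonoOn (a := (k : ℝ) + 1) (b := (k : ℝ) + 2)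
      (by simp) (by simp only [Set.mem_Ici]; linarith) (by linarith)
    simp only [weightSeq]; linarith

theorem weightSeq_antitone (h : IsSubmultiplicative S) : Antitone (weightSeq S) := by
  refine antitone_nat_of_succ_le fun k => ?_
  cases k with
  | zero =>
    have h1 := h.eq_self 1 (by norm_num)
    have h2 := h.eq_self 2 (by norm_num)
    simp only [weightSeq]; norm_num [h1, h2]
  | succ k =>
    have hk : (0 : ℝ) ≤ k := k.cast_nonneg
    have m1 : (k : ℝ) + 1 ∈ Set.Ici (1 : ℝ) := by simp
    have m3 : (k : ℝ) + 3 ∈ Set.Ici (1 : ℝ) := by simp only [Set.mem_Ici]; linarith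
    have hhalf : (0 : ℝ) ≤ 1 / 2 := by norm_num
    have := h.concaveOn.2 m1 m3 hhalf hhalf (by norm_num)
    simp only [smul_eq_mul] at this
    have e : (1 / 2 : ℝ) * (k + 1) + 1 / 2 * (k + 3) = k + 2 := by ring
    rw [e] at this
    simp only [weightSeq]
    push_cast
    have e1 : (k : ℝ) + 1 + 2 = k + 3 := by ring
    have e2 : (k : ℝ) + 1 + 1 = k + 2 := by ring
    rw [e1, e2]; linarith

theorem weightSeq_zero (h : IsSubmultiplicative S) : weightSeq S 0 = 1 := h.eq_self 1 (by norm_num)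

theorem one_le (h : IsSubmultiplicative S) (m : ℕ) : 1 ≤ S ((m : ℝ) + 1) := by
  have h1 := h.eq_self 1 (by norm_num)
  have := h.strictMonoOn.monotoneOn (a := 1) (b := (m : ℝ) + 1) (by simp) (by simp) (by simp)
  linarith

theorem le_self (h : IsSubmultiplicative S) (m : ℕ) : S ((m : ℝ) + 1) ≤ (m : ℝ) + 1 := by
  rw [← sum_weightSeq S m]
  calc _ ≤ ∑ k ∈ Finset.range (m + 1), (1 : ℝ) :=
        Finset.sum_le_sum fun k _ => by
          rw [← h.weightSeq_zero]; exact h.weightSeq_antitone (Nat.zero_le k)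
    _ = _ := by simp

end IsSubmultiplicative

theorem IsIncomparableFamily.unbounded {S : ℕ → ℝ → ℝ} (h : IsIncomparableFamily S) {i j : ℕ}
    (hij : j ≠ i) (M : ℝ) : ∃ m : ℕ, M < S j ((m : ℝ) + 1) / S i ((m : ℝ) + 1) := by
  obtain ⟨n, hn, hM⟩ := h.incomparable {i} (Finset.singleton_nonempty i) j (by simpa using hij) M
  obtain ⟨m, rfl⟩ : ∃ m, n = m + 1 := ⟨n - 1, by omega⟩
  exact ⟨m, by simpa using hM⟩

/-- The weight `w_i(n) = S_i(n) - S_i(n - 1)` corresponding to the `i`-th function. -/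
def IsIncomparableFamily.weight {S : ℕ → ℝ → ℝ} (h : IsIncomparableFamily S) (i : ℕ) :
    LorentzWeight where
  toFun := weightSeq (S i)
  pos := (h.submultiplicative i).weightSeq_pos
  antitone := (h.submultiplicative i).weightSeq_antitone
  map_zero := (h.submultiplicative i).weightSeq_zero
  tendsto_zero := by
    have hi := h.submultiplicative i
    have hbdd : BddBelow (Set.range (weightSeq (S i))) :=
      ⟨0, by rintro _ ⟨k, rfl⟩; exact (hi.weightSeq_pos k).le⟩
    have hlim := tendsto_atTop_ciInf hi.weightSeq_antitone hbdd
    set c := ⨅ k, weightSeq (S i) k with hc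
    have hc0 : 0 ≤ c := le_ciInf fun k => (hi.weightSeq_pos k).le
    rcases hc0.eq_or_lt with h0 | hpos
    · rwa [← h0] at hlim
    · exfalso
      obtain ⟨m, hm⟩ := h.unbounded (i := i) (j := i + 1) (by omega) (1 / c)
      have hj := (h.submultiplicative (i + 1)).le_self m
      have hm1 : (0 : ℝ) < m + 1 := by positivity
      have hlow : c * (m + 1) ≤ S i ((m : ℝ) + 1) := by
        rw [← sum_weightSeq (S i) m]
        calc c * (m + 1) = ∑ k ∈ Finset.range (m + 1), c := by simp [mul_comm]
          _ ≤ _ := Finset.sum_le_sum fun k _ => ciInf_le hbdd k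
      rw [lt_div_iff₀ (by linarith [hi.one_le m])] at hm
      have : 1 / c * (c * (m + 1)) ≤ 1 / c * S i ((m : ℝ) + 1) :=
        mul_le_mul_of_nonneg_left hlow (by positivity)
      have e : 1 / c * (c * ((m : ℝ) + 1)) = m + 1 := by field_simp
      linarith
  not_summable := by
    intro hs
    have hi := h.submultiplicative i
    obtain ⟨m, hm⟩ := h.unbounded (i := i + 1) (j := i) (by omega) (∑' k, weightSeq (S i) k)
    have hj := (h.submultiplicative (i + 1)).one_le m
    have hle : S i ((m : ℝ) + 1) ≤ ∑' k, weightSeq (S i) k := by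
      rw [← sum_weightSeq (S i) m]
      exact hs.sum_le_tsum _ fun k _ => (hi.weightSeq_pos k).le
    have : S i ((m : ℝ) + 1) / S (i + 1) ((m : ℝ) + 1) ≤ S i ((m : ℝ) + 1) :=
      div_le_self (by linarith [hi.one_le m]) hj
    linarith

/-! ### Non-increasing rearrangements -/

/-- The non-increasing rearrangement of `(|a k|)`: `rearrangement a n` is the `(n + 1)`-st largest
of the numbers `|a k|`, counted with multiplicity, i.e. the least `t ≥ 0` such that at most `n` of
them exceed `t`. -/
def rearrangement (a : ℕ → ℝ) (n : ℕ) : ℝ :=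
  sInf {t : ℝ | 0 ≤ t ∧ {k : ℕ | t < |a k|}.encard ≤ n}

section Rearrangement

variable {a b : ℕ → ℝ}

theorem rearrangement_nonneg (a : ℕ → ℝ) (n : ℕ) : 0 ≤ rearrangement a n :=
  Real.sInf_nonneg fun _ ht => ht.1

theorem rearrangement_le {n : ℕ} {t : ℝ} (ht : 0 ≤ t) (h : {k : ℕ | t < |a k|}.encard ≤ n) :
    rearrangement a n ≤ t :=
  csInf_le ⟨0, fun _ hs => hs.1⟩ ⟨ht, h⟩

theorem rearrangement_set_nonempty (ha : Tendsto a atTop (𝓝 0)) (n : ℕ) :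
    {t : ℝ | 0 ≤ t ∧ {k : ℕ | t < |a k|}.encard ≤ n}.Nonempty := by
  obtain ⟨C, hC⟩ := ha.abs.bddAbove_range
  have hC' : ∀ k, |a k| ≤ C := fun k => hC ⟨k, rfl⟩
  refine ⟨C, (abs_nonneg _).trans (hC' 0), ?_⟩
  have : {k : ℕ | C < |a k|} = ∅ := by
    ext k; simpa using hC' k
  rw [this]; simp

theorem le_rearrangement (ha : Tendsto a atTop (𝓝 0)) {F : Finset ℕ} {n : ℕ} (hF : n < F.card)
    {c : ℝ} (h : ∀ k ∈ F, c ≤ |a k|) : c ≤ rearrangement a n := by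
  refine le_csInf (rearrangement_set_nonempty ha n) fun t ht => ?_
  by_contra! hlt
  have hsub : (F : Set ℕ) ⊆ {k : ℕ | t < |a k|} := fun k hk => hlt.trans_le (h k hk)
  have := (Set.encard_le_encard hsub).trans ht.2
  rw [Set.encard_coe_eq_coe_finsetCard] at this
  exact absurd (by exact_mod_cast this) hF.not_ge

theorem sum_abs_le_sum_rearrangement (ha : Tendsto a atTop (𝓝 0)) (m : ℕ) :
    ∀ F : Finset ℕ, F.card = m →
      ∑ k ∈ F, |a k| ≤ ∑ n ∈ Finset.range m, rearrangement a n := by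
  induction m with
  | zero => intro F hF; simp [Finset.card_eq_zero.1 hF]
  | succ m ih =>
    intro F hF
    obtain ⟨k, hk, hmin⟩ := F.exists_min_image (fun k => |a k|) (Finset.card_pos.1 (by omega))
    have h1 := ih (F.erase k) (by rw [Finset.card_erase_of_mem hk]; omega)
    have h2 : |a k| ≤ rearrangement a m := le_rearrangement ha (by omega) hmin
    rw [Finset.sum_range_succ, ← Finset.sum_erase_add _ _ hk]
    exact add_le_add h1 h2

theorem exists_rearrangement_le (ha : Tendsto a atTop (𝓝 0)) (F : Finset ℕ) :
    ∃ k ∉ F, rearrangement a F.card ≤ |a k| := by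
  by_contra! hcon
  set r := rearrangement a F.card with hr
  obtain ⟨k0, hk0⟩ := Infinite.exists_notMem_finset F
  have hr0 : 0 < r := (abs_nonneg _).trans_lt (hcon k0 hk0)
  obtain ⟨K, hK⟩ := eventually_atTop.1 (ha.abs.eventually_lt_const (u := r / 2) (by simpa using hr0))
  obtain ⟨s, hs0, hsr, hs⟩ : ∃ s, 0 ≤ s ∧ s < r ∧ ∀ k ∉ F, |a k| ≤ s := by
    rcases (Finset.range K \ F).eq_empty_or_nonempty with he | hne
    · refine ⟨r / 2, by linarith, by linarith, fun k hk => ?_⟩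
      by_cases hkK : k < K
      · have : k ∈ Finset.range K \ F := by simp [hkK, hk]
        simp [he] at this
      · exact (hK k (by omega)).le
    · obtain ⟨k1, hk1, hmax⟩ := (Finset.range K \ F).exists_max_image (fun k => |a k|) hne
      refine ⟨max (r / 2) |a k1|, le_max_of_le_right (abs_nonneg _),
        max_lt (by linarith) (hcon k1 (Finset.mem_sdiff.1 hk1).2), fun k hk => ?_⟩
      by_cases hkK : k < K
      · exact le_max_of_le_right (hmax k (by simp [hkK, hk]))
      · exact le_max_of_le_left (hK k (by omega)).le
  refine absurd (rearrangement_le (a := a) (n := F.card) hs0 ?_) (by rw [← hr]; exact hsr.not_ge)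
  rw [← Set.encard_coe_eq_coe_finsetCard]
  refine Set.encard_le_encard fun k hk => ?_
  by_contra hkF
  exact (hs k hkF).not_gt hk

theorem exists_sum_rearrangement_le (ha : Tendsto a atTop (𝓝 0)) (m : ℕ) :
    ∃ F : Finset ℕ, F.card = m ∧ ∑ n ∈ Finset.range m, rearrangement a n ≤ ∑ k ∈ F, |a k| := by
  induction m with
  | zero => exact ⟨∅, by simp⟩
  | succ m ih =>
    obtain ⟨F, hF, hsum⟩ := ih
    obtain ⟨k, hk, hle⟩ := exists_rearrangement_le ha F
    refine ⟨insert k F, by rw [Finset.card_insert_of_notMem hk, hF], ?_⟩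
    rw [Finset.sum_range_succ, Finset.sum_insert hk]
    rw [hF] at hle
    linarith

theorem sum_rearrangement_add_le (ha : Tendsto a atTop (𝓝 0)) (hb : Tendsto b atTop (𝓝 0))
    (m : ℕ) : ∑ n ∈ Finset.range m, rearrangement (a + b) n ≤
      ∑ n ∈ Finset.range m, rearrangement a n + ∑ n ∈ Finset.range m, rearrangement b n := by
  have hab : Tendsto (a + b) atTop (𝓝 0) := by
    have := ha.add hb
    rwa [add_zero] at this
  obtain ⟨F, hF, hsum⟩ := exists_sum_rearrangement_le hab m
  calc _ ≤ ∑ k ∈ F, |(a + b) k| := hsum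
    _ ≤ ∑ k ∈ F, (|a k| + |b k|) := Finset.sum_le_sum fun k _ => abs_add_le _ _
    _ = ∑ k ∈ F, |a k| + ∑ k ∈ F, |b k| := Finset.sum_add_distrib
    _ ≤ _ := add_le_add (sum_abs_le_sum_rearrangement ha m F hF)
      (sum_abs_le_sum_rearrangement hb m F hF)

theorem rearrangement_smul_le (ha : Tendsto a atTop (𝓝 0)) (c : ℝ) (n : ℕ) :
    rearrangement (c • a) n ≤ |c| * rearrangement a n := by
  rcases eq_or_ne c 0 with rfl | hc
  · have : rearrangement ((0 : ℝ) • a) n ≤ 0 := rearrangement_le le_rfl (by simp)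
    simpa using this
  · have hc' : 0 < |c| := abs_pos.2 hc
    rw [← div_le_iff₀' hc']
    refine le_csInf (rearrangement_set_nonempty ha n) fun t ht => ?_
    rw [div_le_iff₀' hc']
    refine rearrangement_le (by have := ht.1; positivity) ((Set.encard_le_encard ?_).trans ht.2)
    intro k hk
    simp only [Set.mem_ofPred_eq, Pi.smul_apply, smul_eq_mul, abs_mul] at hk ⊢
    exact lt_of_mul_lt_mul_left hk hc'.le

end Rearrangement

/-! ### The Lorentz sequence space `d(w, 1)` -/

namespace LorentzWeight

variable (w : LorentzWeight)

/-- Membership of a real sequence in `d(w, 1)`: it converges to zero and `∑ a*_n w(n) < ∞`. -/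
def Mem (a : ℕ → ℝ) : Prop :=
  Tendsto a atTop (𝓝 0) ∧ Summable fun n => rearrangement a n * w.toFun n

/-- The norm `∑ a*_n w(n)`. -/
def normFun (a : ℕ → ℝ) : ℝ := ∑' n, rearrangement a n * w.toFun n

variable {w} {a b : ℕ → ℝ}

theorem term_nonneg (w : LorentzWeight) (a : ℕ → ℝ) (n : ℕ) :
    0 ≤ rearrangement a n * w.toFun n :=
  mul_nonneg (rearrangement_nonneg a n) (w.pos n).le

theorem sum_mul_le (w : LorentzWeight) {c : ℕ → ℝ}
    (hc : ∀ m, ∑ n ∈ Finset.range m, c n ≤ 0) (m : ℕ) :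
    ∑ n ∈ Finset.range m, c n * w.toFun n ≤ (∑ n ∈ Finset.range m, c n) * w.toFun m := by
  induction m with
  | zero => simp
  | succ m ih =>
    have h1 := mul_le_mul_of_nonpos_left (w.antitone (Nat.le_succ m)) (hc (m + 1))
    rw [Finset.sum_range_succ] at h1 ⊢
    rw [Finset.sum_range_succ]
    simp only [Nat.succ_eq_add_one] at h1
    linarith

theorem sum_add_le (ha : w.Mem a) (hb : w.Mem b) (m : ℕ) :
    ∑ n ∈ Finset.range m, rearrangement (a + b) n * w.toFun n ≤ w.normFun a + w.normFun b := by
  have hc : ∀ m, ∑ n ∈ Finset.range m,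
      (rearrangement (a + b) n - rearrangement a n - rearrangement b n) ≤ 0 := fun m => by
    have := sum_rearrangement_add_le ha.1 hb.1 m
    simp only [Finset.sum_sub_distrib]; linarith
  have h1 := (w.sum_mul_le hc m).trans
    (mul_nonpos_of_nonpos_of_nonneg (hc m) (w.pos m).le)
  simp only [sub_mul, Finset.sum_sub_distrib] at h1
  have h2 := ha.2.sum_le_tsum (Finset.range m) fun n _ => w.term_nonneg a n
  have h3 := hb.2.sum_le_tsum (Finset.range m) fun n _ => w.term_nonneg b n
  simp only [normFun]; linarith

theorem Mem.add (ha : w.Mem a) (hb : w.Mem b) : w.Mem (a + b) :=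
  ⟨by have := ha.1.add hb.1; rwa [add_zero] at this,
     summable_of_sum_range_le (w.term_nonneg _) (sum_add_le ha hb)⟩

theorem normFun_add_le (ha : w.Mem a) (hb : w.Mem b) :
    w.normFun (a + b) ≤ w.normFun a + w.normFun b :=
  Real.tsum_le_of_sum_range_le (w.term_nonneg _) (sum_add_le ha hb)

theorem smul_term_le (ha : w.Mem a) (c : ℝ) (n : ℕ) :
    rearrangement (c • a) n * w.toFun n ≤ |c| * (rearrangement a n * w.toFun n) := by
  rw [← mul_assoc]
  exact mul_le_mul_of_nonneg_right (rearrangement_smul_le ha.1 c n) (w.pos n).le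

theorem Mem.smul (c : ℝ) (ha : w.Mem a) : w.Mem (c • a) :=
  ⟨by have := ha.1.const_smul c; rwa [smul_zero] at this,
    .of_nonneg_of_le (w.term_nonneg _) (smul_term_le ha c) (ha.2.mul_left _)⟩

theorem normFun_smul_le (c : ℝ) (ha : w.Mem a) : w.normFun (c • a) ≤ |c| * w.normFun a := by
  simp only [normFun, ← tsum_mul_left]
  exact (ha.smul c).2.tsum_le_tsum (smul_term_le ha c) (ha.2.mul_left _)

theorem rearrangement_zero (n : ℕ) : rearrangement 0 n = 0 :=
  le_antisymm (rearrangement_le le_rfl (by simp)) (rearrangement_nonneg 0 n)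

theorem Mem.zero : w.Mem 0 :=
  ⟨tendsto_const_nhds, by simp [rearrangement_zero]⟩

theorem eq_zero_of_normFun (ha : w.Mem a) (h : w.normFun a = 0) : a = 0 := by
  have h0 := ha.2.le_tsum 0 fun n _ => w.term_nonneg a n
  rw [w.map_zero, mul_one] at h0
  funext k
  have h1 : |a k| ≤ rearrangement a 0 := le_rearrangement ha.1 (F := {k}) (by simp) (by simp)
  have h2 : |a k| ≤ 0 := h1.trans (h0.trans h.le)
  simpa using h2

variable (w)

/-- `d(w, 1)` as a vector space of sequences. -/
def submodule : Submodule ℝ (ℕ → ℝ) where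
  carrier := {a | w.Mem a}
  add_mem' := Mem.add
  zero_mem' := Mem.zero
  smul_mem' c _ ha := Mem.smul c ha

end LorentzWeight

/-- The Lorentz sequence space `d(w, 1)`: all real null sequences `a` with `∑ a*_n w(n) < ∞`,
normed by this sum. -/
def LorentzSpace (w : LorentzWeight) : Type := w.submodule

namespace LorentzSpace

variable {w : LorentzWeight}

instance : AddCommGroup (LorentzSpace w) := inferInstanceAs (AddCommGroup w.submodule)

instance : Module ℝ (LorentzSpace w) := inferInstanceAs (Module ℝ w.submodule)

/-- The underlying sequence of an element of `d(w, 1)`. -/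
def seq (a : LorentzSpace w) : ℕ → ℝ := Subtype.val (p := fun a => a ∈ w.submodule) a

theorem mem (a : LorentzSpace w) : w.Mem a.seq :=
  Subtype.property (p := fun a => a ∈ w.submodule) a

instance : NormedAddCommGroup (LorentzSpace w) :=
  AddGroupNorm.toNormedAddCommGroup
    { toFun := fun a => w.normFun a.seq
      map_zero' := by
        change w.normFun 0 = 0
        simp [LorentzWeight.normFun, LorentzWeight.rearrangement_zero]
      add_le' := fun a b => LorentzWeight.normFun_add_le a.mem b.mem
      neg' := fun a => by
        change w.normFun (-a.seq) = w.normFun a.seq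
        simp [LorentzWeight.normFun, rearrangement]
      eq_zero_of_map_eq_zero' := fun a h =>
        Subtype.ext (LorentzWeight.eq_zero_of_normFun a.mem h) }

theorem norm_eq (a : LorentzSpace w) : ‖a‖ = ∑' n, rearrangement a.seq n * w.toFun n := rfl

instance : NormedSpace ℝ (LorentzSpace w) where
  norm_smul_le c a := LorentzWeight.normFun_smul_le c a.mem

end LorentzSpace

/-! ### Spreading models -/

section SpreadingModels

variable {X : Type*} [NormedAddCommGroup X] [NormedSpace ℝ X]

/-- `(x i)` is a basic sequence: a Schauder basis of its closed linear span. -/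
def IsBasicSequence (x : ℕ → X) : Prop :=
  ∃ b : SchauderBasis ℝ (Submodule.span ℝ (Set.range x)).topologicalClosure,
    ∀ i, (b i : X) = x i

/-- `(x i)` converges weakly to zero. -/
def IsWeaklyNull (x : ℕ → X) : Prop :=
  ∀ f : StrongDual ℝ X, Tendsto (fun i => f (x i)) atTop (𝓝 0)

/-- The sequence `x` generates the spreading model `N`. A sequence `(x̃ i)` in a Banach space is
represented by the seminorm `N a = ‖∑ a i • x̃ i‖` on the space `c₀₀` of finitely supported
sequences. The condition: there are `ε_n ↓ 0` with
`(1 + ε_n)⁻¹ ‖∑ a_i x̃_i‖ ≤ ‖∑ a_i x_{k_i}‖ ≤ (1 + ε_n) ‖∑ a_i x̃_i‖` for all `n`, all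
`a_1, …, a_n ∈ [-1, 1]` and all `n ≤ k_1 < ⋯ < k_n`. Sequences are indexed from `0` here, so that
`n ≤ k_i` reads `n ≤ k i + 1`. -/
def GeneratesSpreadingModel (x : ℕ → X) (N : Seminorm ℝ (ℕ →₀ ℝ)) : Prop :=
  ∃ ε : ℕ → ℝ, Antitone ε ∧ Tendsto ε atTop (𝓝 0) ∧
    ∀ (n : ℕ) (a : Fin n → ℝ) (k : Fin n → ℕ), (∀ i, |a i| ≤ 1) → StrictMono k →
      (∀ i, n ≤ k i + 1) →
      (1 + ε n)⁻¹ * N (∑ i : Fin n, Finsupp.single (i : ℕ) (a i)) ≤ ‖∑ i : Fin n, a i • x (k i)‖ ∧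
      ‖∑ i : Fin n, a i • x (k i)‖ ≤ (1 + ε n) * N (∑ i : Fin n, Finsupp.single (i : ℕ) (a i))

variable (X) in
/-- A spreading model of `X` generated by a normalized weakly null basic sequence. -/
structure WeakSpreadingModel where
  toSeminorm : Seminorm ℝ (ℕ →₀ ℝ)
  exists_generating : ∃ x : ℕ → X, (∀ i, ‖x i‖ = 1) ∧ IsBasicSequence x ∧ IsWeaklyNull x ∧
    GeneratesSpreadingModel x toSeminorm

/-- Domination: `N ≤ M` iff `‖∑ a_i x̃_i‖ ≤ C ‖∑ a_i ỹ_i‖` for some constant `C`. -/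
instance : Preorder (WeakSpreadingModel X) where
  le N M := ∃ C : ℝ, ∀ a : ℕ →₀ ℝ, N.toSeminorm a ≤ C * M.toSeminorm a
  le_refl N := ⟨1, fun a => by simp⟩
  le_trans N M P := by
    rintro ⟨C, hC⟩ ⟨D, hD⟩
    refine ⟨|C| * D, fun a => (hC a).trans ?_⟩
    calc C * M.toSeminorm a ≤ |C| * M.toSeminorm a :=
          mul_le_mul_of_nonneg_right (le_abs_self C) (apply_nonneg _ _)
      _ ≤ |C| * (D * P.toSeminorm a) := mul_le_mul_of_nonneg_left (hD a) (abs_nonneg C)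
      _ = |C| * D * P.toSeminorm a := by ring

variable (X) in
/-- `SP_w(X)`: the spreading models of `X` generated by weakly null sequences, up to equivalence
(each dominates the other), partially ordered by domination. -/
abbrev SPw : Type := Antisymmetrization (WeakSpreadingModel X) (· ≤ ·)

end SpreadingModels

/-- The space `X_n(1) = (d(w_1, 1) ⊕ ⋯ ⊕ d(w_n, 1))_∞`: finite products carry the maximum norm. -/
abbrev LorentzSum (w : ℕ → LorentzWeight) (n : ℕ) : Type := ∀ i : Fin n, LorentzSpace (w i)

end

/-! Write Φ_i(m) = w_i(1) + ⋯ + w_i(m) for the fundamental function; for m ≥ 1 it equals S_i(m). For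
nonempty A ⊆ {1, …, n} the diagonal vectors ∑_{i ∈ A} e_k (one unit vector in each summand from A)
are isometrically spreading and generate a model with norm max_{i ∈ A} ‖a‖_{w_i,1}. The claim is
that these are all the models up to equivalence, and that domination between them is inclusion.

Classification. Let (x_k) be normalized and weakly null, and let A collect the summands in which the
sup norms of the components do not tend to zero. The key fact
(`LorentzSpace.exists_normFun_smallPart_le`) is that the entries below δ of a weakly null sequence
in d(w,1) are uniformly small in norm for small δ: otherwise a gliding hump glues blocks carried by
disjoint sets of weights into one functional that is not null along the sequence. Hence components
outside A tend to zero in norm, and A is nonempty.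

For i ∈ A, entries of size at least δ in distinct and almost undisturbed positions give the lower
estimate δ‖a‖ (`LorentzSpace.exists_le_norm_sum`). For the upper estimate (`exists_norm_sum_le`),
cut each vector into dyadic level sets. After passing to a subsequence, the level sets of a given
height have constant size g and are pairwise disjoint, so at that height the combination is the
sequence a with each entry repeated g times. Submultiplicativity bounds the norm of such a dilation
by Φ(g)‖a‖ (`normFun_dilation_le`), and the sum over heights of 2^{-r}Φ(g_r) is at most 4.

Order. If the model of A is dominated by that of B, testing on sums of m unit vectors gives S_i ≤ C
max_{j ∈ B} S_j for i ∈ A, and incomparability forces A ⊆ B.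

Existence. For slowly growing, submultiplicative c on (ℕ, +), the function T(x) = ∑ c_k min(1,
x/2^k) is concave, comparable to c_m at 2^m, and submultiplicative up to the factor 21. Replacing it
by min(x, λT(x)) with λ ≥ 21 removes the constant. Taking c_k = (6/5)^(k + ρ_j(k)), with subadditive
ρ_j that take turns in being much larger than all the others, gives incomparability. -/

noncomputable section

/-! ### Rearrangements and Abel summation -/

section Rearrangement

variable {a b : ℕ → ℝ}

theorem rearrangement_mono (ha : Tendsto a atTop (𝓝 0)) (h : ∀ k, |b k| ≤ |a k|) (n : ℕ) :
    rearrangement b n ≤ rearrangement a n := by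
  refine le_csInf (rearrangement_set_nonempty ha n) fun t ht => rearrangement_le ht.1 ?_
  exact (Set.encard_le_encard fun k hk => lt_of_lt_of_le hk (h k)).trans ht.2

theorem rearrangement_antitone (ha : Tendsto a atTop (𝓝 0)) : Antitone (rearrangement a) := by
  intro m n hmn
  refine le_csInf (rearrangement_set_nonempty ha m) fun t ht => rearrangement_le ht.1 ?_
  exact ht.2.trans (by exact_mod_cast hmn)

theorem rearrangement_le_of_abs_le {t : ℝ} (h : ∀ k, |a k| ≤ t) (n : ℕ) :
    rearrangement a n ≤ t := by
  refine rearrangement_le ((abs_nonneg _).trans (h 0)) ?_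
  have : {k : ℕ | t < |a k|} = ∅ := by
    ext k; simpa using h k
  rw [this]; simp

theorem abs_le_rearrangement_zero (ha : Tendsto a atTop (𝓝 0)) (k : ℕ) :
    |a k| ≤ rearrangement a 0 :=
  le_rearrangement ha (F := {k}) (by simp) (by simp)

theorem tendsto_zero_of_support_subset {F : Finset ℕ} (h : ∀ k ∉ F, a k = 0) :
    Tendsto a atTop (𝓝 0) := by
  refine tendsto_const_nhds.congr' ?_
  filter_upwards [eventually_gt_atTop (F.sup id)] with k hk
  refine (h k fun hkF => ?_).symm
  exact absurd (Finset.le_sup (f := id) hkF) (by simpa using hk)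

theorem rearrangement_eq_zero_of_support_subset {F : Finset ℕ} (h : ∀ k ∉ F, a k = 0) {n : ℕ}
    (hn : F.card ≤ n) : rearrangement a n = 0 := by
  refine le_antisymm (rearrangement_le le_rfl ?_) (rearrangement_nonneg a n)
  have : {k : ℕ | 0 < |a k|} ⊆ F := by
    intro k hk
    by_contra hkF
    simp [h k hkF] at hk
  refine (Set.encard_le_encard this).trans ?_
  rw [Set.encard_coe_eq_coe_finsetCard]
  exact_mod_cast hn

/-- Greedy choice: after n positions are used, some unused position still carries at least the (n +
1)-st largest value. -/
theorem exists_injective_rearrangement_le (ha : Tendsto a atTop (𝓝 0)) :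
    ∃ e : ℕ → ℕ, Function.Injective e ∧ ∀ n, rearrangement a n ≤ |a (e n)| := by
  choose g hg hle using exists_rearrangement_le ha
  let F : ℕ → Finset ℕ := fun n => Nat.rec ∅ (fun _ s => insert (g s) s) n
  have hF : ∀ n, F (n + 1) = insert (g (F n)) (F n) := fun n => rfl
  have hcard : ∀ n, (F n).card = n := by
    intro n
    induction n with
    | zero => rfl
    | succ n ih => rw [hF, Finset.card_insert_of_notMem (hg _), ih]
  have hmono : Monotone F := monotone_nat_of_le_succ fun n => by
    rw [hF]; exact Finset.subset_insert _ _
  refine ⟨fun n => g (F n), ?_, fun n => by simpa [hcard] using hle (F n)⟩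
  have hlt : ∀ m n, m < n → g (F m) ≠ g (F n) := by
    intro m n hmn heq
    refine hg (F n) ?_
    rw [← heq]
    exact hmono (Nat.succ_le_of_lt hmn) (by rw [hF]; exact Finset.mem_insert_self _ _)
  intro m n heq
  rcases lt_trichotomy m n with h | h | h
  · exact absurd heq (hlt m n h)
  · exact h
  · exact absurd heq.symm (hlt n m h)

/-- Abel summation. This turns comparisons of partial sums (majorization) into comparisons of sums
weighted by a decreasing sequence. -/
theorem sum_mul_nonpos_of_partial_sums {b c : ℕ → ℝ} (hb : Antitone b) (hb0 : ∀ n, 0 ≤ b n)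
    (hc : ∀ m, ∑ n ∈ Finset.range m, c n ≤ 0) (m : ℕ) :
    ∑ n ∈ Finset.range m, c n * b n ≤ 0 := by
  have key : ∑ n ∈ Finset.range m, c n * b n ≤ (∑ n ∈ Finset.range m, c n) * b m := by
    induction m with
    | zero => simp
    | succ m ih =>
      have h1 := mul_le_mul_of_nonpos_left (hb (Nat.le_succ m)) (hc (m + 1))
      rw [Finset.sum_range_succ] at h1 ⊢
      rw [Finset.sum_range_succ]
      simp only [Nat.succ_eq_add_one] at h1
      linarith
  exact key.trans (mul_nonpos_of_nonpos_of_nonneg (hc m) (hb0 m))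

end Rearrangement

/-! ### Norm estimates in d(w, 1) -/

namespace LorentzWeight

variable {w : LorentzWeight} {a b : ℕ → ℝ}

theorem le_one (w : LorentzWeight) (n : ℕ) : w.toFun n ≤ 1 := by
  rw [← w.map_zero]; exact w.antitone (Nat.zero_le n)

/-- The fundamental function `w 0 + ⋯ + w (m - 1)`, the norm of a sum of `m` unit vectors. -/
def fundamental (w : LorentzWeight) (m : ℕ) : ℝ := ∑ n ∈ Finset.range m, w.toFun n

theorem fundamental_nonneg (w : LorentzWeight) (m : ℕ) : 0 ≤ w.fundamental m :=
  Finset.sum_nonneg fun n _ => (w.pos n).le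

theorem fundamental_mono (w : LorentzWeight) : Monotone w.fundamental := fun _ _ h =>
  Finset.sum_le_sum_of_subset_of_nonneg (Finset.range_mono h) fun n _ _ => (w.pos n).le

theorem fundamental_tendsto (w : LorentzWeight) : Tendsto w.fundamental atTop atTop :=
  (not_summable_iff_tendsto_nat_atTop_of_nonneg fun n => (w.pos n).le).1 w.not_summable

theorem normFun_nonneg (w : LorentzWeight) (a : ℕ → ℝ) : 0 ≤ w.normFun a :=
  tsum_nonneg (w.term_nonneg a)

theorem Mem.mono (ha : w.Mem a) (h : ∀ k, |b k| ≤ |a k|) : w.Mem b := by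
  refine ⟨?_, ha.2.of_nonneg_of_le (w.term_nonneg b) fun n =>
    mul_le_mul_of_nonneg_right (rearrangement_mono ha.1 h n) (w.pos n).le⟩
  exact squeeze_zero_norm (fun k => h k) (by simpa using ha.1.abs)

theorem normFun_mono (ha : w.Mem a) (h : ∀ k, |b k| ≤ |a k|) : w.normFun b ≤ w.normFun a :=
  (ha.mono h).2.tsum_le_tsum (fun n =>
    mul_le_mul_of_nonneg_right (rearrangement_mono ha.1 h n) (w.pos n).le) ha.2

theorem normFun_eq_sum {F : Finset ℕ} (h : ∀ k ∉ F, a k = 0) {m : ℕ} (hm : F.card ≤ m) :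
    w.normFun a = ∑ n ∈ Finset.range m, rearrangement a n * w.toFun n :=
  tsum_eq_sum fun n hn => by
    rw [rearrangement_eq_zero_of_support_subset h (hm.trans (by simpa using hn)), zero_mul]

theorem mem_of_support_subset {F : Finset ℕ} (h : ∀ k ∉ F, a k = 0) : w.Mem a :=
  ⟨tendsto_zero_of_support_subset h, summable_of_ne_finset_zero (s := Finset.range F.card)
    fun n hn => by
      rw [rearrangement_eq_zero_of_support_subset h (by simpa using hn), zero_mul]⟩

theorem abs_le_normFun (ha : w.Mem a) (k : ℕ) : |a k| ≤ w.normFun a := by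
  have h0 := ha.2.le_tsum 0 fun n _ => w.term_nonneg a n
  rw [w.map_zero, mul_one] at h0
  exact (abs_le_rearrangement_zero ha.1 k).trans h0

/-- Rearrangement inequality: pairing distinct coordinates with the weights is bounded by the
norm. -/
theorem sum_abs_mul_le_normFun (ha : w.Mem a) {q : ℕ → ℕ} {F : Finset ℕ}
    (hq : Set.InjOn q F) : ∑ m ∈ F, |a (q m)| * w.toFun m ≤ w.normFun a := by
  classical
  set c : ℕ → ℝ := fun n => (if n ∈ F then |a (q n)| else 0) - rearrangement a n with hc
  -- At most m distinct values of |a| cannot sum to more than the m largest ones; Abel summation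
  -- against the weights then finishes.
  have hpart : ∀ m, ∑ n ∈ Finset.range m, c n ≤ 0 := by
    intro m
    simp only [hc, Finset.sum_sub_distrib, sub_nonpos]
    rw [← Finset.sum_filter]
    set G := (Finset.range m).filter (· ∈ F) with hG
    have hGF : ∀ n ∈ G, n ∈ F := fun n hn => (Finset.mem_filter.1 hn).2
    have hinj : Set.InjOn q G := hq.mono hGF
    rw [← Finset.sum_image (f := fun k => |a k|) hinj]
    refine (sum_abs_le_sum_rearrangement ha.1 _ _ rfl).trans ?_
    refine Finset.sum_le_sum_of_subset_of_nonneg (Finset.range_mono ?_)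
      fun n _ _ => rearrangement_nonneg a n
    rw [Finset.card_image_of_injOn hinj]
    exact (Finset.card_filter_le _ _).trans (by simp)
  obtain ⟨m, hm⟩ : ∃ m, F ⊆ Finset.range m :=
    ⟨F.sup id + 1, fun n hn => by
      have := Finset.le_sup (f := id) hn
      simp only [id] at this
      simp; omega⟩
  have h1 := sum_mul_nonpos_of_partial_sums w.antitone (fun n => (w.pos n).le) hpart m
  simp only [hc, sub_mul, Finset.sum_sub_distrib, sub_nonpos, ite_mul, zero_mul] at h1
  rw [← Finset.sum_filter, Finset.filter_mem_eq_inter, Finset.inter_eq_right.2 hm] at h1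
  exact h1.trans (ha.2.sum_le_tsum _ fun n _ => w.term_nonneg a n)

/-- If `∑ β_r 1_{G_r} ≤ |a|` for a chain of finite sets `G_r`, then `∑ β_r Φ(|G_r|) ≤ ‖a‖`. -/
theorem sum_mul_fundamental_le {ι : Type*} (ha : w.Mem a) (s : Finset ι) (β : ι → ℝ)
    (G : ι → Finset ℕ) (hβ : ∀ r ∈ s, 0 ≤ β r)
    (hG : ∀ r ∈ s, ∀ r' ∈ s, G r ⊆ G r' ∨ G r' ⊆ G r)
    (h : ∀ k, ∑ r ∈ s, (if k ∈ G r then β r else 0) ≤ |a k|) :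
    ∑ r ∈ s, β r * w.fundamental (G r).card ≤ w.normFun a := by
  classical
  -- Among the sets with more than n elements, the smallest lies in all the others because they form
  -- a chain. On its points |a| is at least the full sum of these β.
  have hre : ∀ n, ∑ r ∈ s with n < (G r).card, β r ≤ rearrangement a n := by
    intro n
    rcases (s.filter fun r => n < (G r).card).eq_empty_or_nonempty with he | hne
    · rw [he, Finset.sum_empty]; exact rearrangement_nonneg a n
    obtain ⟨r, hr, hmin⟩ := Finset.exists_min_image _ (fun r => (G r).card) hne
    rw [Finset.mem_filter] at hr
    refine le_rearrangement ha.1 hr.2 fun k hk => le_trans ?_ (h k)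
    rw [← Finset.sum_filter]
    refine Finset.sum_le_sum_of_subset_of_nonneg (fun r' hr' => ?_)
      fun r' hr' _ => hβ r' (Finset.mem_filter.1 hr').1
    have h1 := hmin r' hr'
    rw [Finset.mem_filter] at hr' ⊢
    refine ⟨hr'.1, ?_⟩
    rcases hG r hr.1 r' hr'.1 with hs | hs
    · exact hs hk
    · rwa [Finset.eq_of_subset_of_card_le hs h1]
  set m := s.sup fun r => (G r).card with hm
  calc ∑ r ∈ s, β r * w.fundamental (G r).card
      = ∑ r ∈ s, ∑ n ∈ Finset.range m, (if n < (G r).card then β r else 0) * w.toFun n := by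
        refine Finset.sum_congr rfl fun r hr => ?_
        rw [fundamental, Finset.mul_sum]
        have hle : (G r).card ≤ m := Finset.le_sup (f := fun r => (G r).card) hr
        refine (Finset.sum_subset_zero_on_sdiff (Finset.range_mono hle) ?_ ?_)
        · intro n hn
          rw [Finset.mem_sdiff, Finset.mem_range, Finset.mem_range] at hn
          rw [if_neg hn.2, zero_mul]
        · intro n hn
          rw [if_pos (Finset.mem_range.1 hn)]
    _ = ∑ n ∈ Finset.range m, (∑ r ∈ s with n < (G r).card, β r) * w.toFun n := by
        rw [Finset.sum_comm]
        refine Finset.sum_congr rfl fun n _ => ?_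
        rw [← Finset.sum_mul, Finset.sum_filter]
    _ ≤ ∑ n ∈ Finset.range m, rearrangement a n * w.toFun n :=
        Finset.sum_le_sum fun n _ => mul_le_mul_of_nonneg_right (hre n) (w.pos n).le
    _ ≤ w.normFun a := ha.2.sum_le_tsum _ fun n _ => w.term_nonneg a n

theorem sum_range_mul_div (f : ℕ → ℝ) (v : ℕ → ℝ) {g : ℕ} (hg : 0 < g) (M : ℕ) :
    ∑ n ∈ Finset.range (M * g), f (n / g) * v n =
      ∑ m ∈ Finset.range M, f m * ∑ q ∈ Finset.range g, v (m * g + q) := by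
  induction M with
  | zero => simp
  | succ M ih =>
    rw [Finset.sum_range_succ, ← ih, Nat.succ_mul, Finset.sum_range_add, Finset.mul_sum]
    congr 1
    refine Finset.sum_congr rfl fun q hq => ?_
    rw [mul_comm M g, Nat.mul_add_div hg, Nat.div_eq_of_lt (Finset.mem_range.1 hq), add_zero]

/-- Repeating every entry of a finite sequence at most `g` times increases the norm at most by the
factor `Φ(g)`, when `Φ` is submultiplicative. -/
theorem normFun_dilation_le (hw : ∀ m g, w.fundamental (m * g) ≤ w.fundamental m * w.fundamental g)
    {n g : ℕ} (ha : ∀ k, n ≤ k → a k = 0) {G : ℕ → Finset ℕ}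
    (hG : ∀ j < n, (G j).card ≤ g)
    (hb : ∀ k, b k ≠ 0 → ∃ j < n, k ∈ G j ∧ |b k| ≤ |a j|) :
    w.normFun b ≤ w.fundamental g * w.normFun a := by
  classical
  have hbF : ∀ k ∉ (Finset.range n).biUnion G, b k = 0 := by
    intro k hk
    by_contra h0
    obtain ⟨j, hj, hkj, -⟩ := hb k h0
    exact hk (Finset.mem_biUnion.2 ⟨j, Finset.mem_range.2 hj, hkj⟩)
  have hcard : ((Finset.range n).biUnion G).card ≤ n * g := by
    refine (Finset.card_biUnion_le_card_mul _ _ g fun j hj => hG j (Finset.mem_range.1 hj)).trans ?_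
    simp
  have haF : ∀ k ∉ Finset.range n, a k = 0 := fun k hk => ha k (by simpa using hk)
  have hanull := tendsto_zero_of_support_subset haF
  rcases Nat.eq_zero_or_pos g with rfl | hg
  · rw [normFun_eq_sum hbF hcard]
    simp only [mul_zero, Finset.range_zero, Finset.sum_empty]
    exact mul_nonneg (w.fundamental_nonneg 0) (w.normFun_nonneg a)
  -- A level set of b is covered by the sets `G j` with j in the same level set of a, so it is at
  -- most g times as large.
  have hre : ∀ m, rearrangement b m ≤ rearrangement a (m / g) := by
    intro m
    refine le_csInf (rearrangement_set_nonempty hanull _) fun t ht => rearrangement_le ht.1 ?_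
    have hfin : {k : ℕ | t < |a k|}.Finite :=
      Set.finite_of_encard_le_coe ht.2
    set E := hfin.toFinset with hE
    have hEcard : E.card ≤ m / g := by
      have := ht.2
      rw [hfin.encard_eq_coe_toFinset_card] at this
      exact_mod_cast this
    have hEn : ∀ j ∈ E, j < n := by
      intro j hj
      by_contra! hnj
      have : t < |a j| := by simpa [hE] using hj
      rw [ha j hnj, abs_zero] at this
      exact absurd ht.1 this.not_ge
    have hsub : {k : ℕ | t < |b k|} ⊆ (E.biUnion G : Finset ℕ) := by
      intro k hk
      have hk' : t < |b k| := hk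
      obtain ⟨j, hj, hkj, hle⟩ := hb k fun h0 => by
        rw [h0, abs_zero] at hk'; exact absurd ht.1 hk'.not_ge
      exact Finset.mem_coe.2 (Finset.mem_biUnion.2 ⟨j, by simpa [hE] using hk'.trans_le hle, hkj⟩)
    refine (Set.encard_le_encard hsub).trans ?_
    rw [Set.encard_coe_eq_coe_finsetCard]
    have h1 := Finset.card_biUnion_le_card_mul E G g fun j hj => hG j (hEn j hj)
    have h2 : E.card * g ≤ m := (Nat.mul_le_mul_right g hEcard).trans (Nat.div_mul_le_self m g)
    exact_mod_cast h1.trans h2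
  -- Adding the weights in blocks of length g gives partial sums Φ(Mg), while Φ(g)w has partial sums
  -- Φ(M)Φ(g). Submultiplicativity is exactly this comparison.
  have hpart : ∀ M, ∑ m ∈ Finset.range M,
      ((∑ q ∈ Finset.range g, w.toFun (m * g + q)) - w.fundamental g * w.toFun m) ≤ 0 := by
    intro M
    rw [Finset.sum_sub_distrib, ← Finset.mul_sum, sub_nonpos]
    have := sum_range_mul_div (fun _ => 1) w.toFun hg M
    simp only [one_mul] at this
    rw [← this, mul_comm (w.fundamental g)]
    exact hw M g
  have h1 := sum_mul_nonpos_of_partial_sums (rearrangement_antitone hanull)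
    (rearrangement_nonneg a) hpart n
  simp only [sub_mul, Finset.sum_sub_distrib, sub_nonpos] at h1
  calc w.normFun b = ∑ m ∈ Finset.range (n * g), rearrangement b m * w.toFun m :=
        normFun_eq_sum hbF hcard
    _ ≤ ∑ m ∈ Finset.range (n * g), rearrangement a (m / g) * w.toFun m :=
        Finset.sum_le_sum fun m _ => mul_le_mul_of_nonneg_right (hre m) (w.pos m).le
    _ = ∑ m ∈ Finset.range n, (∑ q ∈ Finset.range g, w.toFun (m * g + q)) * rearrangement a m := by
        rw [sum_range_mul_div _ _ hg]
        exact Finset.sum_congr rfl fun m _ => mul_comm _ _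
    _ ≤ _ := h1
    _ = w.fundamental g * w.normFun a := by
        rw [normFun_eq_sum haF (by simp : (Finset.range n).card ≤ n), Finset.mul_sum]
        exact Finset.sum_congr rfl fun m _ => by ring

/-- Dominated convergence for the series defining the norm: each rearranged entry tends to zero and
stays below that of a. -/
theorem tendsto_normFun_zero {ι : Type*} {l : Filter ι} {f : ι → ℕ → ℝ} (ha : w.Mem a)
    (hf : ∀ i k, |f i k| ≤ |a k|) (hfl : ∀ ε > 0, ∀ᶠ i in l, ∀ k, |f i k| ≤ ε) :
    Tendsto (fun i => w.normFun (f i)) l (𝓝 0) := by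
  have h0 : ∑' n : ℕ, (0 : ℝ) = 0 := tsum_zero
  rw [← h0]
  refine tendsto_tsum_of_dominated_convergence ha.2 (fun n => ?_) (Eventually.of_forall fun i n => ?_)
  · have h1 : Tendsto (fun i => rearrangement (f i) n) l (𝓝 0) := by
      rw [Metric.tendsto_nhds]
      intro ε hε
      filter_upwards [hfl (ε / 2) (half_pos hε)] with i hi
      rw [Real.dist_eq, sub_zero, abs_of_nonneg (rearrangement_nonneg _ n)]
      exact (rearrangement_le_of_abs_le hi n).trans_lt (half_lt_self hε)
    simpa using h1.mul_const (w.toFun n)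
  · rw [Real.norm_of_nonneg (w.term_nonneg _ n)]
    exact mul_le_mul_of_nonneg_right (rearrangement_mono ha.1 (hf i) n) (w.pos n).le

/-- The part of `a` with entries of absolute value at most `δ`. -/
def smallPart (δ : ℝ) (a : ℕ → ℝ) : ℕ → ℝ := fun k => if |a k| ≤ δ then a k else 0

/-- The part of `a` supported on `[M, ∞)`. -/
def tailPart (M : ℕ) (a : ℕ → ℝ) : ℕ → ℝ := fun k => if M ≤ k then a k else 0

theorem abs_smallPart_le (δ : ℝ) (a : ℕ → ℝ) (k : ℕ) : |smallPart δ a k| ≤ |a k| := by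
  unfold smallPart; split_ifs <;> simp

theorem abs_tailPart_le (M : ℕ) (a : ℕ → ℝ) (k : ℕ) : |tailPart M a k| ≤ |a k| := by
  unfold tailPart; split_ifs <;> simp

theorem tendsto_normFun_smallPart (ha : w.Mem a) :
    Tendsto (fun δ => w.normFun (smallPart δ a)) (𝓝[>] 0) (𝓝 0) := by
  refine tendsto_normFun_zero ha (fun δ => abs_smallPart_le δ a) fun ε hε => ?_
  filter_upwards [(eventually_lt_nhds hε).filter_mono nhdsWithin_le_nhds] with δ hδ k
  unfold smallPart
  split_ifs with h
  · exact h.trans hδ.le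
  · simpa using hε.le

theorem tendsto_normFun_tailPart (ha : w.Mem a) :
    Tendsto (fun M => w.normFun (tailPart M a)) atTop (𝓝 0) := by
  refine tendsto_normFun_zero ha (fun M => abs_tailPart_le M a) fun ε hε => ?_
  obtain ⟨K, hK⟩ := eventually_atTop.1 (ha.1.abs.eventually_lt_const (u := ε) (by simpa using hε))
  filter_upwards [eventually_ge_atTop K] with M hM k
  unfold tailPart
  split_ifs with h
  · exact (hK k (hM.trans h)).le
  · simpa using hε.le

theorem normFun_le_sum_abs {F : Finset ℕ} (h : ∀ k ∉ F, a k = 0) :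
    w.normFun a ≤ ∑ k ∈ F, |a k| := by
  classical
  obtain ⟨E, -, hE⟩ := exists_sum_rearrangement_le (tendsto_zero_of_support_subset h) F.card
  rw [normFun_eq_sum h le_rfl]
  calc _ ≤ ∑ n ∈ Finset.range F.card, rearrangement a n :=
        Finset.sum_le_sum fun n _ =>
          mul_le_of_le_one_right (rearrangement_nonneg a n) (w.le_one n)
    _ ≤ ∑ k ∈ E, |a k| := hE
    _ = ∑ k ∈ E ∩ F, |a k| := by
        refine (Finset.sum_subset Finset.inter_subset_left fun k hk hk' => ?_).symm
        rw [h k fun hF => hk' (Finset.mem_inter.2 ⟨hk, hF⟩), abs_zero]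
    _ ≤ _ := Finset.sum_le_sum_of_subset_of_nonneg Finset.inter_subset_right
        fun k _ _ => abs_nonneg _

/-- The rearrangement inequality read backwards: coordinates are sent injectively to weights instead
of weights to coordinates. -/
theorem sum_abs_mul_weight_le_normFun (ha : w.Mem a) {σ : ℕ → ℕ} {F : Finset ℕ}
    (hσ : Set.InjOn σ F) : ∑ i ∈ F, |a i| * w.toFun (σ i) ≤ w.normFun a := by
  classical
  have hinv : ∀ i ∈ F, Function.invFunOn σ F (σ i) = i := fun i hi =>
    hσ.leftInvOn_invFunOn (Finset.mem_coe.2 hi)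
  have hq : Set.InjOn (Function.invFunOn σ F) (F.image σ : Finset ℕ) := by
    intro m hm m' hm' h
    obtain ⟨i, hi, rfl⟩ := Finset.mem_image.1 (Finset.mem_coe.1 hm)
    obtain ⟨j, hj, rfl⟩ := Finset.mem_image.1 (Finset.mem_coe.1 hm')
    rw [hinv i hi, hinv j hj] at h
    rw [h]
  have := sum_abs_mul_le_normFun ha hq
  rw [Finset.sum_image hσ] at this
  refine le_trans (Finset.sum_le_sum fun i hi => ?_) this
  rw [hinv i hi]

end LorentzWeight

/-! ### Coordinates and functionals on d(w, 1) -/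

namespace LorentzSpace

variable {w : LorentzWeight}

/-- The element of `d(w, 1)` with a given underlying sequence. -/
def ofMem {a : ℕ → ℝ} (h : w.Mem a) : LorentzSpace w := ⟨a, h⟩

theorem seq_ofMem {a : ℕ → ℝ} (h : w.Mem a) : (ofMem h).seq = a := rfl

theorem norm_ofMem {a : ℕ → ℝ} (h : w.Mem a) : ‖ofMem h‖ = w.normFun a := rfl

theorem norm_eq_normFun (x : LorentzSpace w) : ‖x‖ = w.normFun x.seq := rfl

/-- The underlying sequence, as a linear map. -/
def seqLinear (w : LorentzWeight) : LorentzSpace w →ₗ[ℝ] (ℕ → ℝ) := w.submodule.subtype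

theorem ext_seq {x y : LorentzSpace w} (h : x.seq = y.seq) : x = y := Subtype.ext h

theorem seq_add (x y : LorentzSpace w) : (x + y).seq = x.seq + y.seq := rfl

theorem seq_smul (c : ℝ) (x : LorentzSpace w) : (c • x).seq = c • x.seq := rfl

theorem seq_sum {ι : Type*} (s : Finset ι) (f : ι → LorentzSpace w) :
    (∑ i ∈ s, f i).seq = ∑ i ∈ s, (f i).seq :=
  map_sum (seqLinear w) f s

theorem abs_seq_le (x : LorentzSpace w) (k : ℕ) : |x.seq k| ≤ ‖x‖ :=
  LorentzWeight.abs_le_normFun x.mem k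

/-- The `k`-th coordinate functional. -/
def coord (w : LorentzWeight) (k : ℕ) : StrongDual ℝ (LorentzSpace w) :=
  LinearMap.mkContinuous ((LinearMap.proj k).comp (seqLinear w)) 1 fun x => by
    rw [one_mul]; exact abs_seq_le x k

theorem coord_apply (k : ℕ) (x : LorentzSpace w) : coord w k x = x.seq k := rfl

section Pairing

variable {b : ℕ → ℝ} {σ : ℕ → ℕ}

/-- Injectivity of σ is needed only on the support of b, which leaves σ free elsewhere when blocks
are glued together. -/
theorem sum_abs_pairing_le (hσ : Set.InjOn σ {i | b i ≠ 0}) (hb : ∀ i, |b i| ≤ w.toFun (σ i))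
    (x : LorentzSpace w) (F : Finset ℕ) : ∑ i ∈ F, |b i * x.seq i| ≤ ‖x‖ := by
  classical
  have h1 : ∑ i ∈ F, |b i * x.seq i| = ∑ i ∈ F with b i ≠ 0, |b i * x.seq i| := by
    refine (Finset.sum_filter_of_ne fun i _ h => ?_).symm
    rintro h0
    simp [h0] at h
  rw [h1]
  refine le_trans (Finset.sum_le_sum fun i _ => ?_)
    (LorentzWeight.sum_abs_mul_weight_le_normFun x.mem (σ := σ) (F := F.filter fun i => b i ≠ 0)
      (hσ.mono fun i hi => (Finset.mem_filter.1 hi).2))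
  rw [abs_mul, mul_comm]
  exact mul_le_mul_of_nonneg_left (hb i) (abs_nonneg _)

theorem summable_pairing (hσ : Set.InjOn σ {i | b i ≠ 0}) (hb : ∀ i, |b i| ≤ w.toFun (σ i))
    (x : LorentzSpace w) : Summable fun i => b i * x.seq i :=
  (summable_of_sum_le (fun _ => abs_nonneg _) (sum_abs_pairing_le hσ hb x)).of_abs

theorem abs_tsum_pairing_le (hσ : Set.InjOn σ {i | b i ≠ 0}) (hb : ∀ i, |b i| ≤ w.toFun (σ i))
    (x : LorentzSpace w) : |∑' i, b i * x.seq i| ≤ ‖x‖ := by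
  exact le_of_tendsto' (summable_pairing hσ hb x).hasSum.abs fun F =>
    (Finset.abs_sum_le_sum_abs _ _).trans (sum_abs_pairing_le hσ hb x F)

/-- The linear map underlying `pairing`. -/
def pairingLinear (hσ : Set.InjOn σ {i | b i ≠ 0}) (hb : ∀ i, |b i| ≤ w.toFun (σ i)) :
    LorentzSpace w →ₗ[ℝ] ℝ where
  toFun x := ∑' i, b i * x.seq i
  map_add' x y := by
    rw [← (summable_pairing hσ hb x).tsum_add (summable_pairing hσ hb y)]
    exact tsum_congr fun i => by rw [seq_add, Pi.add_apply, mul_add]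
  map_smul' c x := by
    rw [RingHom.id_apply, smul_eq_mul, ← tsum_mul_left]
    exact tsum_congr fun i => by rw [seq_smul, Pi.smul_apply, smul_eq_mul]; ring

/-- The functional on `d(w, 1)` given by a sequence dominated by distinct weights. -/
def pairing (hσ : Set.InjOn σ {i | b i ≠ 0}) (hb : ∀ i, |b i| ≤ w.toFun (σ i)) :
    StrongDual ℝ (LorentzSpace w) :=
  (pairingLinear hσ hb).mkContinuous 1 fun x => by
    rw [one_mul]; exact abs_tsum_pairing_le hσ hb x

theorem pairing_apply (hσ : Set.InjOn σ {i | b i ≠ 0}) (hb : ∀ i, |b i| ≤ w.toFun (σ i))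
    (x : LorentzSpace w) : pairing hσ hb x = ∑' i, b i * x.seq i := rfl

end Pairing

end LorentzSpace

/-! ### The gliding hump -/

namespace LorentzWeight

variable {w : LorentzWeight}

/-- The sum is Φ(L) + Φ(M) − Φ(M + L) ≤ Φ(M) ≤ M. The bound does not depend on L: shifting the
weights by M costs a vector with entries at most δ no more than δM, however long it is. -/
theorem sum_sub_shift_le (w : LorentzWeight) (L M : ℕ) :
    ∑ n ∈ Finset.range L, (w.toFun n - w.toFun (M + n)) ≤ M := by
  have h1 : w.fundamental (M + L) = w.fundamental M + ∑ n ∈ Finset.range L, w.toFun (M + n) :=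
    Finset.sum_range_add _ _ _
  have h2 : w.fundamental L ≤ w.fundamental (M + L) := w.fundamental_mono (by omega)
  have h3 : w.fundamental M ≤ M := by
    refine (Finset.sum_le_sum fun n _ => w.le_one n).trans ?_
    simp
  rw [Finset.sum_sub_distrib]
  change w.fundamental L - _ ≤ _
  linarith

/-- One step of the gliding hump argument. -/
theorem exists_hump {x : ℕ → ℕ → ℝ} (hx : ∀ k, w.Mem (x k))
    (hnull : ∀ p, Tendsto (fun k => x k p) atTop (𝓝 0)) {c : ℝ} (hc : 0 < c)
    (hfail : ∀ δ > 0, ∃ k, c < w.normFun (smallPart δ (x k))) (M : ℕ) :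
    ∃ k M' : ℕ, ∃ β : ℕ → ℝ, ∃ σ : ℕ → ℕ, M ≤ k ∧ M < M' ∧
      (∀ i, β i ≠ 0 → M ≤ i ∧ i < M' ∧ M ≤ σ i ∧ σ i < M') ∧
      (∀ i, |β i| ≤ w.toFun (σ i)) ∧ Set.InjOn σ {i | β i ≠ 0} ∧
      ∑ i ∈ Finset.range M, |x k i| ≤ c / 8 ∧ w.normFun (tailPart M' (x k)) ≤ c / 8 ∧
      c / 2 ≤ ∑ i ∈ Finset.range M', β i * x k i := by
  classical
  have hhead : Tendsto (fun k => ∑ i ∈ Finset.range M, |x k i|) atTop (𝓝 0) := by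
    have := tendsto_finsetSum (Finset.range M) fun i _ => (hnull i).abs
    simpa using this
  obtain ⟨K, hK⟩ := eventually_atTop.1
    (hhead.eventually_lt_const (u := c / 8) (by positivity))
  -- The first condition pays for shifting the weights by M. The second makes the failure at δ
  -- impossible for the finitely many early k, so it must occur late, where the head is negligible.
  obtain ⟨δ, hδ, hδM, hδK⟩ : ∃ δ > 0, δ * M < c / 8 ∧
      ∀ k ∈ Finset.range (max K M), w.normFun (smallPart δ (x k)) < c := by
    have h1 : ∀ᶠ δ : ℝ in 𝓝[>] 0, δ * M < c / 8 := by
      have : Tendsto (fun δ : ℝ => δ * M) (𝓝 0) (𝓝 (0 * M)) := tendsto_id.mul_const _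
      rw [zero_mul] at this
      exact (this.eventually_lt_const (by positivity)).filter_mono nhdsWithin_le_nhds
    have h2 : ∀ᶠ δ : ℝ in 𝓝[>] 0, ∀ k ∈ Finset.range (max K M),
        w.normFun (smallPart δ (x k)) < c :=
      (Finset.eventually_all _).2 fun k _ =>
        (tendsto_normFun_smallPart (hx k)).eventually_lt_const hc
    obtain ⟨δ, ⟨h1, h2⟩, h3⟩ := ((h1.and h2).and self_mem_nhdsWithin).exists
    exact ⟨δ, h3, h1, h2⟩
  obtain ⟨k, hk⟩ := hfail δ hδ
  have hkK : max K M ≤ k := by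
    by_contra! h
    exact absurd (hδK k (Finset.mem_range.2 h)) hk.not_gt
  have hheadk := (hK k ((le_max_left _ _).trans hkK)).le
  set y := smallPart δ (x k) with hy
  have hymem : w.Mem y := (hx k).mono (abs_smallPart_le δ _)
  set v := tailPart M y with hv
  have hvmem : w.Mem v := hymem.mono (abs_tailPart_le M _)
  have hvsmall : ∀ i, |v i| ≤ δ := by
    intro i
    refine (abs_tailPart_le M y i).trans ?_
    simp only [hy, smallPart]
    split_ifs with h
    · exact h
    · simpa using hδ.le
  have hvx : ∀ i, v i ≠ 0 → M ≤ i ∧ v i = x k i := by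
    intro i hi
    simp only [hv, hy, tailPart, smallPart] at hi ⊢
    split_ifs at hi ⊢ with h1 h2
    · exact ⟨h1, rfl⟩
    · exact absurd rfl hi
    · exact absurd rfl hi
  have hvnorm : c - c / 8 < w.normFun v := by
    have hsupp : ∀ i ∉ Finset.range M, (y - v) i = 0 := by
      intro i hi
      have : M ≤ i := by simpa using hi
      simp [hv, tailPart, this]
    have h1 : w.normFun (y - v) ≤ c / 8 := by
      refine (normFun_le_sum_abs hsupp).trans (le_trans (Finset.sum_le_sum fun i hi => ?_) hheadk)
      have : ¬ M ≤ i := by simpa using hi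
      simpa [hv, tailPart, this] using abs_smallPart_le δ (x k) i
    have h2 := normFun_add_le (mem_of_support_subset (w := w) hsupp) hvmem
    rw [sub_add_cancel] at h2
    linarith
  obtain ⟨e, he, hle⟩ := exists_injective_rearrangement_le hvmem.1
  obtain ⟨L, hL⟩ := (hvmem.2.hasSum.tendsto_sum_nat.eventually_const_lt
    (show c - c / 8 < ∑' n, rearrangement v n * w.toFun n from hvnorm)).exists
  obtain ⟨M', hM'L, hM'e, hM'⟩ : ∃ M', M + L < M' ∧ (∀ n < L, e n < M') ∧
      w.normFun (tailPart M' (x k)) ≤ c / 8 := by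
    obtain ⟨M', h1, h2, h3⟩ := ((eventually_gt_atTop (M + L)).and
      ((eventually_gt_atTop ((Finset.range L).sup e)).and
        ((tendsto_normFun_tailPart (hx k)).eventually_lt_const
          (show 0 < c / 8 by positivity)))).exists
    exact ⟨M', h1, fun n hn =>
      (Finset.le_sup (f := e) (Finset.mem_range.2 hn)).trans_lt h2, h3.le⟩
  set q := Function.invFun e with hq
  have hqe : ∀ n, q (e n) = n := Function.leftInverse_invFun he
  -- The n-th largest entry is paired with weight M + n rather than n, so that successive blocks use
  -- disjoint sets of weights.
  set σ : ℕ → ℕ := fun i => M + q i with hσ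
  set β : ℕ → ℝ := fun i => if v i ≠ 0 ∧ i ∈ (Finset.range L).image e then
    (SignType.sign (v i) : ℝ) * w.toFun (M + q i) else 0 with hβ
  have hβne : ∀ i, β i ≠ 0 → v i ≠ 0 ∧ ∃ n < L, e n = i := by
    intro i hi
    simp only [hβ] at hi
    split_ifs at hi with h
    · obtain ⟨n, hn, rfl⟩ := Finset.mem_image.1 h.2
      exact ⟨h.1, n, Finset.mem_range.1 hn, rfl⟩
    · exact absurd rfl hi
  refine ⟨k, M', β, σ, (le_max_right _ _).trans hkK, by omega, ?_, ?_, ?_, hheadk, hM', ?_⟩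
  · intro i hi
    obtain ⟨h0, n, hn, rfl⟩ := hβne i hi
    refine ⟨(hvx _ h0).1, hM'e n hn, ?_, ?_⟩ <;> simp only [hσ, hqe] <;> omega
  · intro i
    simp only [hβ]
    split_ifs with h
    · rw [abs_mul, abs_of_pos (w.pos _)]
      refine mul_le_of_le_one_left (w.pos _).le ?_
      rcases SignType.trichotomy (SignType.sign (v i)) with h | h | h <;> simp [h]
    · simpa using (w.pos _).le
  · intro i hi j hj hij
    obtain ⟨-, n, -, rfl⟩ := hβne i hi
    obtain ⟨-, m, -, rfl⟩ := hβne j hj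
    simp only [hσ, hqe] at hij
    rw [show n = m by omega]
  · have hsub : (Finset.range L).image e ⊆ Finset.range M' := by
      intro i hi
      obtain ⟨n, hn, rfl⟩ := Finset.mem_image.1 hi
      exact Finset.mem_range.2 (hM'e n (Finset.mem_range.1 hn))
    have h1 : ∑ i ∈ Finset.range M', β i * x k i =
        ∑ n ∈ Finset.range L, |v (e n)| * w.toFun (M + n) := by
      rw [← Finset.sum_subset hsub fun i _ hi => by simp only [hβ]; rw [if_neg (by tauto), zero_mul],
        Finset.sum_image he.injOn]
      refine Finset.sum_congr rfl fun n hn => ?_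
      by_cases h0 : v (e n) = 0
      · simp [hβ, h0]
      · have h2 : e n ∈ (Finset.range L).image e := Finset.mem_image_of_mem e hn
        simp only [hβ]
        rw [if_pos ⟨h0, h2⟩, hqe, ← (hvx _ h0).2, mul_right_comm, sign_mul_self]
    rw [h1]
    have h2 : ∑ n ∈ Finset.range L, rearrangement v n * w.toFun (M + n) ≤
        ∑ n ∈ Finset.range L, |v (e n)| * w.toFun (M + n) :=
      Finset.sum_le_sum fun n _ => mul_le_mul_of_nonneg_right (hle n) (w.pos _).le
    -- The loss caused by the shifted weights; the entries of v are at most δ.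
    have h3 : ∑ n ∈ Finset.range L, rearrangement v n * (w.toFun n - w.toFun (M + n)) ≤ δ * M := by
      refine (Finset.sum_le_sum fun n _ => mul_le_mul_of_nonneg_right
        (rearrangement_le_of_abs_le hvsmall n)
        (sub_nonneg.2 (w.antitone (Nat.le_add_left n M)))).trans ?_
      rw [← Finset.mul_sum]
      exact mul_le_mul_of_nonneg_left (w.sum_sub_shift_le L M) hδ.le
    simp only [mul_sub, Finset.sum_sub_distrib] at h3
    linarith

end LorentzWeight

namespace LorentzSpace

variable {w : LorentzWeight}

theorem tendsto_seq_of_isWeaklyNull {x : ℕ → LorentzSpace w} (hx : IsWeaklyNull x) (p : ℕ) :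
    Tendsto (fun k => (x k).seq p) atTop (𝓝 0) := hx (coord w p)

theorem exists_block {M : ℕ → ℕ} (hM : StrictMono M) (h0 : M 0 = 0) (i : ℕ) :
    ∃ j, M j ≤ i ∧ i < M (j + 1) := by
  have hex : ∃ j, i < M (j + 1) := ⟨i, (Nat.lt_succ_self i).trans_le (hM.id_le (i + 1))⟩
  refine ⟨Nat.find hex, ?_, Nat.find_spec hex⟩
  rcases h : Nat.find hex with _ | j
  · omega
  · exact not_lt.1 (Nat.find_min hex (m := j) (by omega))

theorem block_unique {M : ℕ → ℕ} (hM : StrictMono M) {i j j' : ℕ} (h1 : M j ≤ i)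
    (h2 : i < M (j + 1)) (h1' : M j' ≤ i) (h2' : i < M (j' + 1)) : j = j' := by
  have := hM.lt_iff_lt.1 (h1.trans_lt h2')
  have := hM.lt_iff_lt.1 (h1'.trans_lt h2)
  omega

/-- The small entries of a weakly null sequence in `d(w, 1)` are uniformly small in norm. -/
theorem exists_normFun_smallPart_le {x : ℕ → LorentzSpace w} (hx : IsWeaklyNull x) {c : ℝ}
    (hc : 0 < c) : ∃ δ > 0, ∀ k, w.normFun (LorentzWeight.smallPart δ (x k).seq) ≤ c := by
  by_contra! hfail
  choose k M' β σ hk hM' hβ hβw hσ hhead htail hsum using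
    LorentzWeight.exists_hump (w := w) (fun k => (x k).mem) (tendsto_seq_of_isWeaklyNull hx) hc hfail
  let M : ℕ → ℕ := fun n => Nat.rec 0 (fun _ m => M' m) n
  have hMs : ∀ j, M (j + 1) = M' (M j) := fun j => rfl
  have hM : StrictMono M := strictMono_nat_of_lt_succ fun j => hM' (M j)
  choose J hJ1 hJ2 using exists_block hM rfl
  set b : ℕ → ℝ := fun i => β (M (J i)) i with hb
  set τ : ℕ → ℕ := fun i => σ (M (J i)) i with hτ
  -- On block j the weight indices lie in [M j, M (j + 1)), so an index determines its block, and
  -- within a block σ is injective.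
  have hτinj : Set.InjOn τ {i | b i ≠ 0} := by
    intro i hi i' hi' heq
    have h1 := hβ _ _ hi
    have h2 := hβ _ _ hi'
    have hJJ : J i = J i' := by
      refine block_unique hM (i := τ i) h1.2.2.1 h1.2.2.2 ?_ ?_
      · rw [heq]; exact h2.2.2.1
      · rw [heq]; exact h2.2.2.2
    simp only [hτ, hb, Set.mem_ofPred_eq] at heq hi hi'
    rw [← hJJ] at heq hi'
    exact hσ _ hi hi' heq
  have hbw : ∀ i, |b i| ≤ w.toFun (τ i) := fun i => hβw _ i
  have hbβ : ∀ j, ∀ i, M j ≤ i → i < M (j + 1) → b i = β (M j) i := by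
    intro j i h1 h2
    simp only [hb]
    rw [block_unique hM (hJ1 i) (hJ2 i) h1 h2]
  -- Block j contributes at least c/2; the blocks before and after it cost at most c/8 each.
  have hlow : ∀ j, c / 4 ≤ pairing hτinj hbw (x (k (M j))) := by
    intro j
    set y := x (k (M j)) with hy
    have htmem : w.Mem (LorentzWeight.tailPart (M (j + 1)) y.seq) :=
      y.mem.mono (LorentzWeight.abs_tailPart_le _ _)
    have h1 : ∑' i, b i * y.seq i =
        ∑ i ∈ Finset.range (M (j + 1)), b i * y.seq i +
          ∑' i, b i * (ofMem htmem).seq i := by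
      have e1 := (summable_pairing hτinj hbw y).sum_add_tsum_nat_add (M (j + 1))
      have e2 := (summable_pairing hτinj hbw (ofMem htmem)).sum_add_tsum_nat_add (M (j + 1))
      have e3 : ∑ i ∈ Finset.range (M (j + 1)), b i * (ofMem htmem).seq i = 0 :=
        Finset.sum_eq_zero fun i hi => by
          have : ¬ M (j + 1) ≤ i := by simpa using hi
          rw [seq_ofMem, LorentzWeight.tailPart, if_neg this, mul_zero]
      rw [e3, zero_add] at e2
      rw [← e1, ← e2]
      congr 1
      refine tsum_congr fun i => ?_
      rw [seq_ofMem, LorentzWeight.tailPart, if_pos (Nat.le_add_left _ _)]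
    have h2 := (abs_le.1 (abs_tsum_pairing_le hτinj hbw (ofMem htmem))).1
    rw [norm_ofMem] at h2
    have h3 := htail (M j)
    rw [← hMs] at h3
    have hle : M j ≤ M (j + 1) := hM.monotone (Nat.le_succ j)
    have h4 : ∑ i ∈ Finset.range (M (j + 1)), β (M j) i * y.seq i - c / 8 ≤
        ∑ i ∈ Finset.range (M (j + 1)), b i * y.seq i := by
      rw [← Finset.sum_range_add_sum_Ico _ hle, ← Finset.sum_range_add_sum_Ico _ hle]
      have e1 : ∑ i ∈ Finset.range (M j), β (M j) i * y.seq i = 0 :=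
        Finset.sum_eq_zero fun i hi => by
          have : β (M j) i = 0 := by
            by_contra h
            exact absurd (hβ _ _ h).1 (by simpa using hi)
          rw [this, zero_mul]
      have e2 : ∑ i ∈ Finset.Ico (M j) (M (j + 1)), b i * y.seq i =
          ∑ i ∈ Finset.Ico (M j) (M (j + 1)), β (M j) i * y.seq i :=
        Finset.sum_congr rfl fun i hi => by
          rw [hbβ j i (Finset.mem_Ico.1 hi).1 (Finset.mem_Ico.1 hi).2]
      have e3 : -(c / 8) ≤ ∑ i ∈ Finset.range (M j), b i * y.seq i := by
        refine (abs_le.1 ((Finset.abs_sum_le_sum_abs _ _).trans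
          (le_trans (Finset.sum_le_sum fun i _ => ?_) (hhead (M j))))).1
        rw [abs_mul]
        exact mul_le_of_le_one_left (abs_nonneg _) ((hbw i).trans (w.le_one _))
      rw [e1, e2]
      linarith
    have h5 := hsum (M j)
    rw [← hMs] at h5
    rw [pairing_apply, h1]
    linarith
  have hk' : Tendsto (fun j => k (M j)) atTop atTop :=
    tendsto_atTop_mono (fun j => hk (M j)) hM.tendsto_atTop
  have := ge_of_tendsto' ((hx (pairing hτinj hbw)).comp hk') hlow
  linarith

end LorentzSpace

/-! ### Extraction of subsequences -/

section Extraction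

/-- Each admissible index is compatible with all late admissible ones. Asking the next index to be
compatible with every admissible one up to the current index, chosen or not, makes the recursion
depend on the last choice only. -/
theorem exists_strictMono_pairwise {P : ℕ → Prop} {R : ℕ → ℕ → Prop} (hP : ∃ᶠ k in atTop, P k)
    (hR : ∀ j, P j → ∀ᶠ k in atTop, P k → R j k) (K : ℕ) :
    ∃ φ : ℕ → ℕ, StrictMono φ ∧ K ≤ φ 0 ∧ (∀ j, P (φ j)) ∧ ∀ j k, j < k → R (φ j) (φ k) := by
  have hstep : ∀ m, ∃ k, m < k ∧ P k ∧ ∀ j ≤ m, P j → R j k := by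
    intro m
    have h1 : ∀ᶠ k in atTop, ∀ j ∈ Finset.range (m + 1), P j → P k → R j k := by
      refine (Finset.eventually_all _).2 fun j _ => ?_
      by_cases hj : P j
      · filter_upwards [hR j hj] with k hk _ using hk
      · exact Eventually.of_forall fun k h => absurd h hj
    obtain ⟨k, hk, h2, h3⟩ := (hP.and_eventually (h1.and (eventually_gt_atTop m))).exists
    exact ⟨k, h3, hk, fun j hj hPj => h2 j (Finset.mem_range.2 (by omega)) hPj hk⟩
  choose g hg1 hg2 hg3 using hstep
  let φ : ℕ → ℕ := fun n => Nat.rec (g K) (fun _ m => g m) n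
  have hφ : ∀ n, φ (n + 1) = g (φ n) := fun n => rfl
  have hmono : StrictMono φ := strictMono_nat_of_lt_succ fun n => hg1 (φ n)
  have hPφ : ∀ n, P (φ n) := fun n => by cases n <;> exact hg2 _
  refine ⟨φ, hmono, (hg1 K).le, hPφ, fun j k hjk => ?_⟩
  obtain ⟨k, rfl⟩ : ∃ l, k = l + 1 := ⟨k - 1, by omega⟩
  exact hg3 (φ k) (φ j) (hmono.monotone (by omega)) (hPφ j)

end Extraction

/-! ### Late subsequences and the spreading model -/

section SpreadingBounds

variable {X : Type*} [NormedAddCommGroup X] [NormedSpace ℝ X]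

theorem sum_single_fin_eq {n : ℕ} {a : ℕ →₀ ℝ} (ha : ∀ k, n ≤ k → a k = 0) :
    ∑ i : Fin n, Finsupp.single (i : ℕ) (a i) = a := by
  rw [← Finset.sum_range fun i => Finsupp.single i (a i)]
  ext k
  rw [Finsupp.finsetSum_apply]
  simp only [Finsupp.single_apply, Finset.sum_ite_eq', Finset.mem_range]
  split_ifs with h
  · rfl
  · exact (ha k (not_lt.1 h)).symm

/-- All sufficiently late finite subsequences of a generating sequence are uniformly equivalent to
the spreading model. -/
theorem GeneratesSpreadingModel.exists_bounds {x : ℕ → X} {N : Seminorm ℝ (ℕ →₀ ℝ)}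
    (h : GeneratesSpreadingModel x N) : ∃ C > 0, ∀ (n : ℕ) (a : ℕ →₀ ℝ), (∀ k, n ≤ k → a k = 0) →
      ∀ φ : ℕ → ℕ, StrictMono φ → n ≤ φ 0 →
        N a ≤ C * ‖∑ j ∈ Finset.range n, a j • x (φ j)‖ ∧
          ‖∑ j ∈ Finset.range n, a j • x (φ j)‖ ≤ C * N a := by
  obtain ⟨ε, hanti, hlim, hε⟩ := h
  have hε0 : ∀ n, 0 ≤ ε n := fun n => hanti.le_of_tendsto hlim n
  have hC : 0 < 1 + ε 0 := by linarith [hε0 0]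
  refine ⟨1 + ε 0, hC, fun n a ha φ hφ hn => ?_⟩
  -- Normalization bringing the coefficients into [-1, 1]; the added 1 keeps t positive when a = 0.
  set t := ∑ j ∈ Finset.range n, |a j| + 1 with ht
  have hsum0 : 0 ≤ ∑ j ∈ Finset.range n, |a j| := Finset.sum_nonneg fun _ _ => abs_nonneg _
  have ht0 : 0 < t := by linarith
  set a' : ℕ →₀ ℝ := t⁻¹ • a with ha'
  have hle1 : ∀ i : Fin n, |a' i| ≤ 1 := by
    intro i
    rw [ha', Finsupp.smul_apply, smul_eq_mul, abs_mul, abs_of_pos (inv_pos.2 ht0),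
      inv_mul_le_iff₀ ht0]
    have := Finset.single_le_sum (f := fun j => |a j|) (fun _ _ => abs_nonneg _)
      (Finset.mem_range.2 i.2)
    linarith
  have hk : ∀ i : Fin n, n ≤ φ i + 1 := fun i =>
    hn.trans ((hφ.monotone (Nat.zero_le _)).trans (Nat.le_succ _))
  obtain ⟨h1, h2⟩ := hε n (fun i => a' i) (fun i => φ i) hle1 (fun i j hij => hφ hij) hk
  rw [sum_single_fin_eq (a := a') fun k hk => by simp [ha', ha k hk]] at h1 h2
  have hN : N a' = t⁻¹ * N a := by
    rw [ha', map_smul_eq_mul, Real.norm_of_nonneg (inv_nonneg.2 ht0.le)]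
  have hsum : ‖∑ i : Fin n, a' i • x (φ i)‖ =
      t⁻¹ * ‖∑ j ∈ Finset.range n, a j • x (φ j)‖ := by
    rw [← Finset.sum_range fun i => a' i • x (φ i)]
    simp only [ha', Finsupp.smul_apply, smul_eq_mul, ← smul_smul]
    rw [← Finset.smul_sum, norm_smul, Real.norm_of_nonneg (inv_nonneg.2 ht0.le)]
  rw [hN, hsum] at h1 h2
  have hεn : 1 + ε n ≤ 1 + ε 0 := by linarith [hanti (Nat.zero_le n)]
  have hpos : 0 < 1 + ε n := by linarith [hε0 n]
  have hti := inv_pos.2 ht0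
  constructor
  · rw [inv_mul_le_iff₀ hpos, mul_left_comm, mul_le_mul_iff_right₀ hti] at h1
    exact h1.trans (mul_le_mul_of_nonneg_right hεn (norm_nonneg _))
  · rw [mul_left_comm, mul_le_mul_iff_right₀ hti] at h2
    exact h2.trans (mul_le_mul_of_nonneg_right hεn (apply_nonneg _ _))

end SpreadingBounds

/-! ### The lower estimate -/

namespace LorentzSpace

variable {w : LorentzWeight}

/-- Each chosen x_k has an entry of size at least δ at a position p_k. Along a sparse subsequence
the other vectors are below θ there, so the combination has modulus at least δ|a_j| − θ∑|a_i| at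
distinct positions, and the rearrangement inequality applies. -/
theorem exists_le_norm_sum {x : ℕ → LorentzSpace w}
    (hnull : ∀ p, Tendsto (fun k => (x k).seq p) atTop (𝓝 0)) {δ : ℝ} (hδ : 0 < δ)
    (hx : ∃ᶠ k in atTop, ∃ p, δ ≤ |(x k).seq p|) {n : ℕ} {a : ℕ → ℝ} (ha : ∀ k, n ≤ k → a k = 0)
    {η : ℝ} (hη : 0 < η) (K : ℕ) : ∃ φ : ℕ → ℕ, StrictMono φ ∧ K ≤ φ 0 ∧
      δ * w.normFun a ≤ ‖∑ j ∈ Finset.range n, a j • x (φ j)‖ + η := by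
  classical
  have haF : ∀ k ∉ Finset.range n, a k = 0 := fun k hk => ha k (by simpa using hk)
  set A := ∑ j ∈ Finset.range n, |a j| with hA
  have hA0 : 0 ≤ A := Finset.sum_nonneg fun _ _ => abs_nonneg _
  -- θ ≤ δ makes the positions distinct; the other bound keeps the total error nAθ below η.
  set θ := min δ (η / (n * A + 1)) with hθ
  have hθ0 : 0 < θ := lt_min hδ (by positivity)
  have hp : ∀ k, ∃ p, (∃ p, δ ≤ |(x k).seq p|) → δ ≤ |(x k).seq p| := by
    intro k
    by_cases h : ∃ p, δ ≤ |(x k).seq p|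
    · obtain ⟨p, hp⟩ := h; exact ⟨p, fun _ => hp⟩
    · exact ⟨0, fun h' => absurd h' h⟩
  choose p hp using hp
  obtain ⟨φ, hφ, hK, hφp, hφR⟩ := exists_strictMono_pairwise
    (P := fun k => ∃ p, δ ≤ |(x k).seq p|)
    (R := fun l k => |(x k).seq (p l)| < θ ∧ |(x l).seq (p k)| < θ) hx (by
      intro l hl
      obtain ⟨m, hm⟩ := eventually_atTop.1 ((x l).mem.1.abs.eventually_lt_const (u := θ)
        (by simpa using hθ0))
      -- This pushes p_k beyond m, where the fixed vector x_l is already below θ.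
      have h2 : ∀ᶠ k in atTop, ∀ q ∈ Finset.range m, |(x k).seq q| < δ :=
        (Finset.eventually_all _).2 fun q _ =>
          (hnull q).abs.eventually_lt_const (by simpa using hδ)
      filter_upwards [(hnull (p l)).abs.eventually_lt_const (u := θ) (by simpa using hθ0), h2]
        with k hk1 hk2 hPk
      refine ⟨hk1, hm _ ?_⟩
      by_contra! hlt
      exact absurd (hp k hPk) (hk2 _ (Finset.mem_range.2 hlt)).not_ge) K
  refine ⟨φ, hφ, hK, ?_⟩
  set y := ∑ j ∈ Finset.range n, a j • x (φ j) with hy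
  have hyseq : ∀ q, y.seq q = ∑ j ∈ Finset.range n, a j * (x (φ j)).seq q := by
    intro q
    rw [hy, seq_sum, Finset.sum_apply]
    rfl
  have hoff : ∀ i j, i ≠ j → |(x (φ i)).seq (p (φ j))| < θ := by
    intro i j hij
    rcases lt_or_gt_of_ne hij with h | h
    · exact (hφR i j h).2
    · exact (hφR j i h).1
  have hpinj : Function.Injective fun j => p (φ j) := by
    intro i j hij
    by_contra hne
    have h1 := hoff i j hne
    simp only at hij
    rw [← hij] at h1
    exact absurd (hp _ (hφp i)) (h1.trans_le (min_le_left _ _)).not_ge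
  have hlow : ∀ j < n, |a j| * δ - A * θ ≤ |y.seq (p (φ j))| := by
    intro j hj
    rw [hyseq, ← Finset.add_sum_erase _ _ (Finset.mem_range.2 hj)]
    have h1 : |∑ i ∈ (Finset.range n).erase j, a i * (x (φ i)).seq (p (φ j))| ≤ A * θ := by
      refine (Finset.abs_sum_le_sum_abs _ _).trans ?_
      rw [hA, Finset.sum_mul]
      refine (Finset.sum_le_sum fun i hi => ?_).trans
        (Finset.sum_le_sum_of_subset_of_nonneg (Finset.erase_subset _ _)
          fun i _ _ => mul_nonneg (abs_nonneg (a i)) hθ0.le)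
      rw [abs_mul]
      exact mul_le_mul_of_nonneg_left (hoff i j (Finset.ne_of_mem_erase hi)).le (abs_nonneg _)
    have h2 : |a j| * δ ≤ |a j * (x (φ j)).seq (p (φ j))| := by
      rw [abs_mul]
      exact mul_le_mul_of_nonneg_left (hp _ (hφp j)) (abs_nonneg _)
    have h3 := abs_sub_abs_le_abs_add (a j * (x (φ j)).seq (p (φ j)))
      (∑ i ∈ (Finset.range n).erase j, a i * (x (φ i)).seq (p (φ j)))
    linarith
  obtain ⟨e, he, hle⟩ := exists_injective_rearrangement_le (tendsto_zero_of_support_subset haF)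
  set F := (Finset.range n).filter fun m => e m < n with hF
  have hinj : Set.InjOn (fun m => p (φ (e m))) F := (hpinj.comp he).injOn
  have h1 := LorentzWeight.sum_abs_mul_le_normFun y.mem hinj
  have h2 : w.normFun a ≤ ∑ m ∈ F, |a (e m)| * w.toFun m := by
    rw [LorentzWeight.normFun_eq_sum haF (by simp : (Finset.range n).card ≤ n)]
    refine (Finset.sum_le_sum fun m _ => mul_le_mul_of_nonneg_right (hle m) (w.pos m).le).trans ?_
    refine (Finset.sum_filter_of_ne fun m _ hm => ?_).ge
    by_contra! hlt
    rw [ha _ hlt] at hm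
    simp at hm
  have h3 : ∑ m ∈ F, (|a (e m)| * δ - A * θ) * w.toFun m ≤
      ∑ m ∈ F, |y.seq (p (φ (e m)))| * w.toFun m :=
    Finset.sum_le_sum fun m hm => mul_le_mul_of_nonneg_right
      (hlow (e m) (Finset.mem_filter.1 hm).2) (w.pos m).le
  have h4 : ∑ m ∈ F, A * θ * w.toFun m ≤ η := by
    calc ∑ m ∈ F, A * θ * w.toFun m ≤ ∑ m ∈ F, A * θ :=
          Finset.sum_le_sum fun m _ => mul_le_of_le_one_right (by positivity) (w.le_one m)
      _ = F.card * (A * θ) := by rw [Finset.sum_const, nsmul_eq_mul]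
      _ ≤ n * (A * θ) := by
          refine mul_le_mul_of_nonneg_right ?_ (by positivity)
          exact_mod_cast (Finset.card_filter_le _ _).trans (by simp)
      _ = (n * A) * θ := by ring
      _ ≤ (n * A) * (η / (n * A + 1)) :=
          mul_le_mul_of_nonneg_left (min_le_right _ _) (by positivity)
      _ ≤ η := by
          rw [mul_div_assoc', div_le_iff₀ (by positivity)]
          nlinarith [mul_nonneg (n.cast_nonneg (α := ℝ)) hA0]
  simp only [sub_mul, Finset.sum_sub_distrib] at h3
  have h5 : ∑ m ∈ F, |a (e m)| * δ * w.toFun m = δ * ∑ m ∈ F, |a (e m)| * w.toFun m := by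
    rw [Finset.mul_sum]; exact Finset.sum_congr rfl fun m _ => by ring
  have h6 := mul_le_mul_of_nonneg_left h2 hδ.le
  rw [norm_eq_normFun]
  linarith

end LorentzSpace

/-! ### The upper estimate by dyadic levels -/

section DyadicLevels

theorem le_sum_dyadic {t : ℝ} (ht1 : t ≤ 1) (R : ℕ) :
    (if t ≤ (1 / 2 : ℝ) ^ R then 0 else t) ≤
      ∑ r ∈ Finset.range R, if (1 / 2 : ℝ) ^ (r + 1) < t then (1 / 2 : ℝ) ^ r else 0 := by
  induction R with
  | zero => simp [ht1]
  | succ R ih =>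
    rw [Finset.sum_range_succ]
    have h0 : 0 ≤ ∑ r ∈ Finset.range R, if (1 / 2 : ℝ) ^ (r + 1) < t then (1 / 2 : ℝ) ^ r else 0 :=
      Finset.sum_nonneg fun r _ => by split_ifs <;> positivity
    have hp : (1 / 2 : ℝ) ^ (R + 1) = (1 / 2) ^ R / 2 := by ring
    have hp0 : 0 < (1 / 2 : ℝ) ^ R := by positivity
    split_ifs at ih ⊢ <;> linarith

/-- A geometric series with largest term below 2t. Together with `le_sum_dyadic` it shows that |x|
is its dyadic layer sum up to the factor 4 and entries at most 2^{-R}. -/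
theorem sum_dyadic_le {t : ℝ} (ht : 0 ≤ t) (R : ℕ) :
    ∑ r ∈ Finset.range R, (if (1 / 2 : ℝ) ^ (r + 1) < t then (1 / 2 : ℝ) ^ r else 0) ≤ 4 * t := by
  -- Reserving the geometric tail 2 · 2^{-R} lets the induction close.
  have key : ∑ r ∈ Finset.range R, (if (1 / 2 : ℝ) ^ (r + 1) < t then (1 / 2 : ℝ) ^ r else 0) ≤
      max 0 (4 * t - 2 * (1 / 2) ^ R) := by
    induction R with
    | zero => simp
    | succ R ih =>
      rw [Finset.sum_range_succ]
      have hp : (1 / 2 : ℝ) ^ (R + 1) = (1 / 2) ^ R / 2 := by ring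
      have hp0 : 0 < (1 / 2 : ℝ) ^ R := by positivity
      rcases le_max_iff.1 ih with h | h
      · split_ifs with h'
        · exact le_max_of_le_right (by linarith)
        · exact le_max_of_le_left (by linarith)
      · split_ifs with h'
        · exact le_max_of_le_right (by linarith)
        · exact le_max_of_le_left (by linarith)
  refine key.trans (max_le (by linarith) ?_)
  have : (0 : ℝ) < (1 / 2) ^ R := by positivity
  linarith

end DyadicLevels

namespace LorentzSpace

variable {w : LorentzWeight}

theorem finite_level (x : LorentzSpace w) {t : ℝ} (ht : 0 < t) : {p | t < |x.seq p|}.Finite := by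
  obtain ⟨m, hm⟩ := eventually_atTop.1 (x.mem.1.abs.eventually_lt_const (u := t) (by simpa using ht))
  refine (Finset.range m).finite_toSet.subset fun p hp => ?_
  by_contra h
  have hp' : t < |x.seq p| := hp
  exact lt_asymm hp' (hm p (by simpa using h))

/-- The `r`-th dyadic level set of an element of `d(w, 1)`. -/
def level (x : LorentzSpace w) (r : ℕ) : Finset ℕ :=
  (finite_level x (t := (1 / 2 : ℝ) ^ (r + 1)) (by positivity)).toFinset

theorem mem_level {x : LorentzSpace w} {r p : ℕ} :
    p ∈ level x r ↔ (1 / 2 : ℝ) ^ (r + 1) < |x.seq p| := by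
  simp [level]

theorem level_mono (x : LorentzSpace w) : Monotone (level x) := by
  intro r s hrs p hp
  rw [mem_level] at hp ⊢
  exact lt_of_le_of_lt (pow_le_pow_of_le_one (by norm_num) (by norm_num) (by omega)) hp

/-- The layer sum is pointwise at most 4|x| and the level sets form a chain, so
`sum_mul_fundamental_le` applies to 4x. -/
theorem sum_level_le (x : LorentzSpace w) (hx : ‖x‖ ≤ 1) (R : ℕ) :
    ∑ r ∈ Finset.range R, (1 / 2 : ℝ) ^ r * w.fundamental (level x r).card ≤ 4 := by
  refine (LorentzWeight.sum_mul_fundamental_le ((4 : ℝ) • x).mem (Finset.range R) _ (level x)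
    (fun r _ => by positivity) (fun r _ s _ => ?_) fun k => ?_).trans ?_
  · rcases le_total r s with h | h
    · exact Or.inl (level_mono x h)
    · exact Or.inr (level_mono x h)
  · simp only [mem_level]
    refine (sum_dyadic_le (abs_nonneg _) R).trans ?_
    rw [seq_smul, Pi.smul_apply, smul_eq_mul, abs_mul, abs_of_pos (by norm_num : (0 : ℝ) < 4)]
  · rw [← norm_eq_normFun, norm_smul, Real.norm_of_nonneg (by norm_num)]
    linarith

/-- On the unit ball 2^{-r}Φ(|level|) ≤ 4, and Φ is unbounded. The uniform bound makes the later
pigeonhole on cardinalities possible. -/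
theorem exists_card_level_le (w : LorentzWeight) (r : ℕ) :
    ∃ B, ∀ x : LorentzSpace w, ‖x‖ ≤ 1 → (level x r).card ≤ B := by
  obtain ⟨B, hB⟩ := eventually_atTop.1
    (w.fundamental_tendsto.eventually_gt_atTop (4 / (1 / 2 : ℝ) ^ r))
  refine ⟨B, fun x hx => ?_⟩
  by_contra! h
  have h1 := hB _ h.le
  rw [div_lt_iff₀ (by positivity), mul_comm] at h1
  have h2 := sum_level_le x hx (r + 1)
  rw [Finset.sum_range_succ] at h2
  have h3 : 0 ≤ ∑ s ∈ Finset.range r, (1 / 2 : ℝ) ^ s * w.fundamental (level x s).card :=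
    Finset.sum_nonneg fun s _ => mul_nonneg (by positivity) (w.fundamental_nonneg _)
  linarith

/-- At height r the combination is dominated by 2^{-r} times a dilation of a with multiplicity g_r,
of norm at most 2^{-r}Φ(g_r)‖a‖. Since all vectors have the same g_r, summing over r costs only the
factor 4 of a single vector. -/
theorem norm_sum_le_of_levels
    (hw : ∀ m g, w.fundamental (m * g) ≤ w.fundamental m * w.fundamental g)
    {n R : ℕ} {a : ℕ → ℝ} (ha : ∀ k, n ≤ k → a k = 0) {y : ℕ → LorentzSpace w}
    (hy : ∀ j, ‖y j‖ ≤ 1) {c : ℝ}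
    (hsmall : ∀ j, w.normFun (LorentzWeight.smallPart ((1 / 2) ^ R) (y j).seq) ≤ c)
    (hcard : ∀ r < R, ∀ j, (level (y j) r).card = (level (y 0) r).card)
    (hdisj : ∀ i j, i ≠ j → ∀ r < R, Disjoint (level (y i) r) (level (y j) r)) :
    ‖∑ j ∈ Finset.range n, a j • y j‖ ≤
      4 * w.normFun a + (∑ j ∈ Finset.range n, |a j|) * c := by
  classical
  have hsm : ∀ j, w.Mem (LorentzWeight.smallPart ((1 / 2) ^ R) (y j).seq) := fun j =>
    (y j).mem.mono (LorentzWeight.abs_smallPart_le _ _)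
  set s : ℕ → LorentzSpace w := fun j => ofMem (hsm j) with hs
  have hsplit : ∑ j ∈ Finset.range n, a j • y j =
      ∑ j ∈ Finset.range n, a j • (y j - s j) + ∑ j ∈ Finset.range n, a j • s j := by
    rw [← Finset.sum_add_distrib]
    exact Finset.sum_congr rfl fun j _ => by rw [← smul_add, sub_add_cancel]
  have hs_le : ‖∑ j ∈ Finset.range n, a j • s j‖ ≤ (∑ j ∈ Finset.range n, |a j|) * c := by
    refine (norm_sum_le _ _).trans ?_
    rw [Finset.sum_mul]
    refine Finset.sum_le_sum fun j _ => ?_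
    rw [norm_smul, Real.norm_eq_abs]
    exact mul_le_mul_of_nonneg_left (hsmall j) (abs_nonneg _)
  set B : ℕ → ℕ → ℝ := fun r p =>
    ∑ j ∈ Finset.range n, if p ∈ level (y j) r then |a j| else 0 with hB
  have hBsupp : ∀ r, ∀ p ∉ (Finset.range n).biUnion (fun j => level (y j) r), B r p = 0 := by
    intro r p hp
    refine Finset.sum_eq_zero fun j hj => if_neg fun h => hp ?_
    exact Finset.mem_biUnion.2 ⟨j, hj, h⟩
  have hBmem : ∀ r, w.Mem (B r) := fun r => LorentzWeight.mem_of_support_subset (hBsupp r)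
  have hBnorm : ∀ r < R, w.normFun (B r) ≤ w.fundamental (level (y 0) r).card * w.normFun a := by
    intro r hr
    refine LorentzWeight.normFun_dilation_le hw ha (G := fun j => level (y j) r)
      (fun j _ => (hcard r hr j).le) fun p hp => ?_
    obtain ⟨j, hj, hjp⟩ := Finset.exists_ne_zero_of_sum_ne_zero hp
    have hpj : p ∈ level (y j) r := by
      by_contra h
      exact hjp (if_neg h)
    refine ⟨j, Finset.mem_range.1 hj, hpj, ?_⟩
    have : B r p = |a j| := by
      rw [hB]
      simp only
      rw [Finset.sum_eq_single_of_mem j hj, if_pos hpj]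
      intro i _ hij
      exact if_neg fun h => Finset.disjoint_left.1 (hdisj i j hij r hr) h hpj
    rw [this, abs_abs]
  -- Pointwise domination: each entry exceeding 2^{-R} in modulus is at most the sum of the heights
  -- of its layers.
  have hbig : ‖∑ j ∈ Finset.range n, a j • (y j - s j)‖ ≤
      ‖∑ r ∈ Finset.range R, (1 / 2 : ℝ) ^ r • ofMem (hBmem r)‖ := by
    rw [norm_eq_normFun, norm_eq_normFun]
    refine LorentzWeight.normFun_mono (mem _) fun p => ?_
    rw [seq_sum, seq_sum, Finset.sum_apply, Finset.sum_apply]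
    refine le_trans ?_ (le_abs_self _)
    refine (Finset.abs_sum_le_sum_abs _ _).trans ?_
    have h1 : ∀ j, |(a j • (y j - s j)).seq p| ≤
        ∑ r ∈ Finset.range R, (1 / 2 : ℝ) ^ r * if p ∈ level (y j) r then |a j| else 0 := by
      intro j
      have h2 : (a j • (y j - s j)).seq p = a j * ((y j).seq p -
        LorentzWeight.smallPart ((1 / 2) ^ R) (y j).seq p) := rfl
      have h3 : |(y j).seq p - LorentzWeight.smallPart ((1 / 2) ^ R) (y j).seq p| =
          if |(y j).seq p| ≤ (1 / 2 : ℝ) ^ R then 0 else |(y j).seq p| := by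
        rw [LorentzWeight.smallPart]; split_ifs <;> simp
      rw [h2, abs_mul, h3]
      refine (mul_le_mul_of_nonneg_left
        (le_sum_dyadic ((abs_seq_le _ p).trans (hy j)) R) (abs_nonneg _)).trans ?_
      rw [Finset.mul_sum]
      refine Finset.sum_le_sum fun r _ => ?_
      simp only [mem_level]
      split_ifs
      · rw [mul_comm]
      · simp
    refine (Finset.sum_le_sum fun j _ => h1 j).trans ?_
    rw [Finset.sum_comm]
    refine Finset.sum_le_sum fun r _ => ?_
    rw [← Finset.mul_sum]
    rfl
  have hB_le : ‖∑ r ∈ Finset.range R, (1 / 2 : ℝ) ^ r • ofMem (hBmem r)‖ ≤ 4 * w.normFun a := by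
    calc _ ≤ ∑ r ∈ Finset.range R, ‖(1 / 2 : ℝ) ^ r • ofMem (hBmem r)‖ := norm_sum_le _ _
      _ ≤ ∑ r ∈ Finset.range R,
          ((1 / 2 : ℝ) ^ r * w.fundamental (level (y 0) r).card) * w.normFun a := by
          refine Finset.sum_le_sum fun r hr => ?_
          rw [norm_smul, Real.norm_of_nonneg (by positivity), mul_assoc]
          exact mul_le_mul_of_nonneg_left (hBnorm r (Finset.mem_range.1 hr)) (by positivity)
      _ ≤ 4 * w.normFun a := by
          rw [← Finset.sum_mul]
          exact mul_le_mul_of_nonneg_right (sum_level_le _ (hy 0) R) (w.normFun_nonneg a)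
  rw [hsplit]
  exact (norm_add_le _ _).trans (add_le_add (hbig.trans hB_le) hs_le)

end LorentzSpace

section UpperEstimate

variable {ι : Type*} [Fintype ι] {w : ι → LorentzWeight}

/-- One subsequence serves all summands at once: R comes from the uniform smallness of small
entries, equal cardinalities from pigeonhole, and disjoint levels from coordinatewise convergence to
zero. -/
theorem exists_norm_sum_le
    (hw : ∀ i m g, (w i).fundamental (m * g) ≤ (w i).fundamental m * (w i).fundamental g)
    {x : ℕ → ∀ i, LorentzSpace (w i)} (hx : ∀ k i, ‖x k i‖ ≤ 1)
    (hnull : ∀ i, IsWeaklyNull fun k => x k i) {n : ℕ} {a : ℕ → ℝ} (ha : ∀ k, n ≤ k → a k = 0)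
    {η : ℝ} (hη : 0 < η) (K : ℕ) : ∃ φ : ℕ → ℕ, StrictMono φ ∧ K ≤ φ 0 ∧
      ∀ i, ‖∑ j ∈ Finset.range n, a j • x (φ j) i‖ ≤ 4 * (w i).normFun a + η := by
  classical
  set A := ∑ j ∈ Finset.range n, |a j| with hA
  have hA0 : 0 ≤ A := Finset.sum_nonneg fun _ _ => abs_nonneg _
  have hc : 0 < η / (A + 1) := by positivity
  choose δ hδ hsmall using fun i => LorentzSpace.exists_normFun_smallPart_le (hnull i) hc
  obtain ⟨R, hR⟩ : ∃ R : ℕ, ∀ i, (1 / 2 : ℝ) ^ R ≤ δ i := by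
    have : ∀ᶠ R : ℕ in atTop, ∀ i, (1 / 2 : ℝ) ^ R ≤ δ i := eventually_all.2 fun i =>
      (tendsto_pow_atTop_nhds_zero_of_lt_one (by norm_num) (by norm_num)).eventually_le_const (hδ i)
    exact this.exists
  choose B hB using fun (i : ι) (r : ℕ) => LorentzSpace.exists_card_level_le (w i) r
  -- The table of all level cardinalities takes finitely many values, so one table occurs infinitely
  -- often.
  let κ : ℕ → ∀ (i : ι) (r : Fin R), Fin (B i r + 1) := fun k i r =>
    ⟨(LorentzSpace.level (x k i) r).card, Nat.lt_succ_of_le (hB i r _ (hx k i))⟩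
  obtain ⟨g, hg⟩ := Finite.exists_infinite_fiber κ
  have hfreq : ∃ᶠ k in atTop, κ k = g :=
    Nat.frequently_atTop_iff_infinite.2 (Set.infinite_coe_iff.1 hg)
  obtain ⟨φ, hφ, hK, hφg, hφR⟩ := exists_strictMono_pairwise
    (R := fun l k => ∀ i, ∀ r ∈ Finset.range R, ∀ p ∈ LorentzSpace.level (x l i) r,
      |(x k i).seq p| < (1 / 2 : ℝ) ^ (r + 1)) hfreq (by
      intro l _
      have : ∀ᶠ k in atTop, ∀ i, ∀ r ∈ Finset.range R, ∀ p ∈ LorentzSpace.level (x l i) r,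
          |(x k i).seq p| < (1 / 2 : ℝ) ^ (r + 1) :=
        eventually_all.2 fun i => (Finset.eventually_all _).2 fun r _ =>
          (Finset.eventually_all _).2 fun p _ =>
            (LorentzSpace.tendsto_seq_of_isWeaklyNull (hnull i) p).abs.eventually_lt_const
              (by simp)
      exact this.mono fun k hk _ => hk) K
  refine ⟨φ, hφ, hK, fun i => ?_⟩
  have hdisj : ∀ j k, j < k → ∀ r < R,
      Disjoint (LorentzSpace.level (x (φ j) i) r) (LorentzSpace.level (x (φ k) i) r) := by
    intro j k hjk r hr
    rw [Finset.disjoint_left]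
    intro p hp hp'
    exact lt_asymm (hφR j k hjk i r (Finset.mem_range.2 hr) p hp) (LorentzSpace.mem_level.1 hp')
  refine (LorentzSpace.norm_sum_le_of_levels (hw i) ha (y := fun j => x (φ j) i) (R := R)
    (fun j => hx _ i) (c := η / (A + 1)) (fun j => ?_) (fun r hr j => ?_) ?_).trans ?_
  · refine (LorentzWeight.normFun_mono
      ((x (φ j) i).mem.mono (LorentzWeight.abs_smallPart_le (δ i) _)) fun p => ?_).trans
      (hsmall i (φ j))
    simp only [LorentzWeight.smallPart]
    have := hR i
    split_ifs with h1 h2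
    · exact le_rfl
    · exact absurd (h1.trans this) h2
    · simp
    · simp
  · have h1 := congrArg (fun f => ((f i ⟨r, hr⟩ : Fin _) : ℕ)) ((hφg j).trans (hφg 0).symm)
    exact h1
  · intro j k hjk r hr
    rcases lt_or_gt_of_ne hjk with h | h
    · exact hdisj j k h r hr
    · exact (hdisj k j h r hr).symm
  · have : A * (η / (A + 1)) ≤ η := by
      rw [mul_div_assoc', div_le_iff₀ (by positivity)]
      nlinarith
    linarith

end UpperEstimate

/-! ### Unit vectors -/

namespace LorentzWeight

variable {w : LorentzWeight}

theorem mem_finsupp (w : LorentzWeight) (a : ℕ →₀ ℝ) : w.Mem a :=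
  mem_of_support_subset (F := a.support) fun _ hk => Finsupp.notMem_support_iff.1 hk

theorem rearrangement_congr {a b : ℕ → ℝ}
    (h : ∀ t, 0 ≤ t → {k | t < |a k|}.encard = {k | t < |b k|}.encard) :
    rearrangement a = rearrangement b := by
  funext n
  unfold rearrangement
  congr 1
  ext t
  simp only [Set.mem_ofPred_eq]
  exact and_congr_right fun ht => by rw [h t ht]

theorem encard_level_sum_single {n : ℕ} (c : Fin n → ℝ) {k : Fin n → ℕ}
    (hk : Function.Injective k) {t : ℝ} (ht : 0 ≤ t) :
    {p | t < |(∑ i, Finsupp.single (k i) (c i) : ℕ →₀ ℝ) p|}.encard =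
      {i | t < |c i|}.encard := by
  have happ : ∀ j, (∑ i, Finsupp.single (k i) (c i) : ℕ →₀ ℝ) (k j) = c j := by
    intro j
    rw [Finsupp.finsetSum_apply, Finset.sum_eq_single j]
    · simp
    · intro i _ hij
      rw [Finsupp.single_apply, if_neg fun h => hij (hk h)]
    · simp
  rw [← hk.encard_image]
  congr 1
  ext p
  simp only [Set.mem_ofPred_eq, Set.mem_image]
  constructor
  · intro hp
    by_cases hpk : ∃ i, k i = p
    · obtain ⟨i, rfl⟩ := hpk
      rw [happ] at hp
      exact ⟨i, hp, rfl⟩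
    · exfalso
      push Not at hpk
      rw [Finsupp.finsetSum_apply, Finset.sum_eq_zero] at hp
      · rw [abs_zero] at hp; exact absurd ht hp.not_ge
      · intro i _
        rw [Finsupp.single_apply, if_neg (hpk i)]
  · rintro ⟨i, hi, rfl⟩
    rwa [happ]

/-- The rearrangement sees only the sizes of level sets, so coefficients may be moved along any
injection. Hence unit vectors generate their own spreading model with zero error. -/
theorem normFun_sum_single {n : ℕ} (c : Fin n → ℝ) {k : Fin n → ℕ} (hk : Function.Injective k) :
    w.normFun (∑ i, Finsupp.single (k i) (c i) : ℕ →₀ ℝ) =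
      w.normFun (∑ i : Fin n, Finsupp.single (i : ℕ) (c i) : ℕ →₀ ℝ) := by
  unfold normFun
  rw [rearrangement_congr fun t ht => ?_]
  rw [encard_level_sum_single c hk ht, encard_level_sum_single c Fin.val_injective ht]

theorem normFun_le_fundamental {a : ℕ → ℝ} {F : Finset ℕ} (h0 : ∀ k ∉ F, a k = 0)
    (h1 : ∀ k, |a k| ≤ 1) : w.normFun a ≤ w.fundamental F.card := by
  rw [normFun_eq_sum h0 le_rfl]
  exact Finset.sum_le_sum fun n _ =>
    mul_le_of_le_one_left (w.pos n).le (rearrangement_le_of_abs_le h1 n)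

theorem fundamental_le_normFun {a : ℕ → ℝ} (ha : w.Mem a) {F : Finset ℕ}
    (h1 : ∀ k ∈ F, 1 ≤ |a k|) : w.fundamental F.card ≤ w.normFun a := by
  have := sum_mul_fundamental_le ha {()} (fun _ => 1) (fun _ => F) (by simp) (by simp)
    fun k => by
      simp only [Finset.sum_singleton]
      split_ifs with h
      · exact h1 k h
      · exact abs_nonneg _
  simpa using this

theorem tendsto_fundamental_div (w : LorentzWeight) :
    Tendsto (fun m : ℕ => (m : ℝ)⁻¹ * w.fundamental m) atTop (𝓝 0) :=
  w.tendsto_zero.cesaro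

end LorentzWeight

namespace LorentzSpace

/-- The inclusion of the finitely supported sequences in `d(w, 1)`. -/
def ofFinsupp (w : LorentzWeight) : (ℕ →₀ ℝ) →ₗ[ℝ] LorentzSpace w where
  toFun a := ofMem (w.mem_finsupp a)
  map_add' _ _ := ext_seq (by simp only [seq_add, seq_ofMem, Finsupp.coe_add])
  map_smul' _ _ := ext_seq (by simp only [seq_smul, seq_ofMem, Finsupp.coe_smul, RingHom.id_apply])

variable {w : LorentzWeight}

theorem seq_ofFinsupp (a : ℕ →₀ ℝ) : (ofFinsupp w a).seq = a := rfl

theorem norm_ofFinsupp (a : ℕ →₀ ℝ) : ‖ofFinsupp w a‖ = w.normFun a := rfl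

theorem norm_ofFinsupp_single (k : ℕ) : ‖ofFinsupp w (Finsupp.single k 1)‖ = 1 := by
  rw [norm_ofFinsupp]
  refine le_antisymm ?_ ?_
  · refine (LorentzWeight.normFun_le_sum_abs (F := {k}) fun p hp => ?_).trans ?_
    · rw [Finsupp.single_apply, if_neg fun h => hp (by simp [h])]
    · simp
  · have := LorentzWeight.abs_le_normFun (w.mem_finsupp (Finsupp.single k 1)) k
    simpa using this

/-- If |f(e_k)| ≥ ε infinitely often, signed sums of m such vectors give εm ≤ ‖f‖Φ(m), whereas
Φ(m)/m → 0 because it is the Cesàro mean of a null sequence. -/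
theorem isWeaklyNull_ofFinsupp_single :
    IsWeaklyNull fun k => ofFinsupp w (Finsupp.single k 1) := by
  intro f
  rw [Metric.tendsto_nhds]
  intro ε hε
  by_contra hcon
  rw [not_eventually] at hcon
  set S := {k : ℕ | ¬ dist (f (ofFinsupp w (Finsupp.single k 1))) 0 < ε} with hS
  have hinf : S.Infinite := Nat.frequently_atTop_iff_infinite.1 hcon
  have hf : 0 < ‖f‖ + 1 := by positivity
  obtain ⟨m, hm, hm0⟩ := (((w.tendsto_fundamental_div).eventually_lt_const
    (u := ε / (‖f‖ + 1)) (by positivity)).and (eventually_gt_atTop 0)).exists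
  obtain ⟨F, hFS, hF⟩ := hinf.exists_subset_card_eq m
  set v : ℕ → ℝ := fun k => f (ofFinsupp w (Finsupp.single k 1)) with hv
  set a : ℕ →₀ ℝ := ∑ k ∈ F, Finsupp.single k (SignType.sign (v k) : ℝ) with ha
  have haapp : ∀ p, a p = if p ∈ F then (SignType.sign (v p) : ℝ) else 0 := by
    intro p
    rw [ha, Finsupp.finsetSum_apply]
    simp only [Finsupp.single_apply, Finset.sum_ite_eq']
  have h1 : ε * m ≤ f (ofFinsupp w a) := by
    have : f (ofFinsupp w a) = ∑ k ∈ F, |v k| := by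
      rw [ha, map_sum, map_sum]
      refine Finset.sum_congr rfl fun k _ => ?_
      rw [show Finsupp.single k (SignType.sign (v k) : ℝ) =
        (SignType.sign (v k) : ℝ) • Finsupp.single k (1 : ℝ) by simp, map_smul, map_smul,
        smul_eq_mul]
      exact sign_mul_self _
    rw [this, ← hF, mul_comm, ← nsmul_eq_mul]
    refine Finset.card_nsmul_le_sum _ _ _ fun k hk => ?_
    have h := hFS hk
    simp only [hS, Set.mem_ofPred_eq, not_lt, Real.dist_eq, sub_zero] at h
    exact h
  have h2 : ‖ofFinsupp w a‖ ≤ w.fundamental m := by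
    rw [norm_ofFinsupp, ← hF]
    refine LorentzWeight.normFun_le_fundamental (fun k hk => ?_) fun k => ?_
    · rw [haapp, if_neg hk]
    · rw [haapp]
      split_ifs
      · rcases SignType.trichotomy (SignType.sign (v k)) with h | h | h <;> simp [h]
      · simp
  have h3 : f (ofFinsupp w a) ≤ (‖f‖ + 1) * w.fundamental m :=
    (le_abs_self _).trans ((f.le_opNorm _).trans
      (mul_le_mul (by linarith) h2 (norm_nonneg _) hf.le))
  have hm0' : (0 : ℝ) < m := by exact_mod_cast hm0
  rw [lt_div_iff₀ hf, inv_mul_eq_div, div_mul_eq_mul_div, div_lt_iff₀ hm0'] at hm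
  linarith

theorem tendsto_sum_coord (y : LorentzSpace w) :
    Tendsto (fun n => ∑ k ∈ Finset.range n, y.seq k • ofFinsupp w (Finsupp.single k 1)) atTop
      (𝓝 y) := by
  rw [tendsto_iff_norm_sub_tendsto_zero]
  refine (LorentzWeight.tendsto_normFun_tailPart y.mem).congr fun n => ?_
  rw [norm_sub_rev, norm_eq_normFun]
  congr 1
  funext p
  have h1 : (y - ∑ k ∈ Finset.range n, y.seq k • ofFinsupp w (Finsupp.single k 1)).seq p =
      y.seq p - (∑ k ∈ Finset.range n, y.seq k • ofFinsupp w (Finsupp.single k 1)).seq p := rfl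
  rw [h1, seq_sum, Finset.sum_apply]
  simp only [seq_smul, Pi.smul_apply, seq_ofFinsupp, smul_eq_mul, Finsupp.single_apply,
    mul_ite, mul_one, mul_zero, Finset.sum_ite_eq', Finset.mem_range, LorentzWeight.tailPart]
  split_ifs with h2 h3 h3
  · omega
  · simp
  · simp
  · omega

end LorentzSpace

/-! ### Diagonal spreading models -/

section CanonicalModels

open Classical in
/-- The diagonal embedding of the finitely supported sequences in the coordinates `i ∈ A` of
a sum of Lorentz spaces. -/
def diagonal {ι : Type*} (w : ι → LorentzWeight) (A : Finset ι) :
    (ℕ →₀ ℝ) →ₗ[ℝ] (∀ i, LorentzSpace (w i)) :=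
  LinearMap.pi fun i => if i ∈ A then LorentzSpace.ofFinsupp (w i) else 0

variable {ι : Type*} {w : ι → LorentzWeight} {A : Finset ι}

theorem diagonal_of_mem (a : ℕ →₀ ℝ) {i : ι} (hi : i ∈ A) :
    diagonal w A a i = LorentzSpace.ofFinsupp (w i) a := by
  simp [diagonal, hi]

theorem diagonal_of_notMem (a : ℕ →₀ ℝ) {i : ι} (hi : i ∉ A) : diagonal w A a i = 0 := by
  simp [diagonal, hi]

variable [Fintype ι]

theorem norm_diagonal_le_iff {a : ℕ →₀ ℝ} {C : ℝ} (hC : 0 ≤ C) :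
    ‖diagonal w A a‖ ≤ C ↔ ∀ i ∈ A, (w i).normFun a ≤ C := by
  rw [pi_norm_le_iff_of_nonneg hC]
  refine forall_congr' fun i => ?_
  by_cases hi : i ∈ A
  · simp [diagonal_of_mem a hi, hi, LorentzSpace.norm_ofFinsupp]
  · simp [diagonal_of_notMem a hi, hi, hC]

theorem normFun_le_norm_diagonal (a : ℕ →₀ ℝ) {i : ι} (hi : i ∈ A) :
    (w i).normFun a ≤ ‖diagonal w A a‖ :=
  (norm_diagonal_le_iff (norm_nonneg _)).1 le_rfl i hi

theorem norm_diagonal_single (hA : A.Nonempty) (k : ℕ) :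
    ‖diagonal w A (Finsupp.single k 1)‖ = 1 := by
  have h1 : ∀ i, (w i).normFun (Finsupp.single k 1 : ℕ →₀ ℝ) = 1 := fun i =>
    LorentzSpace.norm_ofFinsupp_single k
  obtain ⟨i, hi⟩ := hA
  refine le_antisymm ((norm_diagonal_le_iff zero_le_one).2 fun i _ => (h1 i).le) ?_
  exact (h1 i).ge.trans (normFun_le_norm_diagonal _ hi)

theorem norm_diagonal_congr {a b : ℕ →₀ ℝ} (h : ∀ i, (w i).normFun a = (w i).normFun b) :
    ‖diagonal w A a‖ = ‖diagonal w A b‖ := by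
  refine le_antisymm ?_ ?_
  · refine (norm_diagonal_le_iff (norm_nonneg _)).2 fun i hi => ?_
    rw [h]; exact normFun_le_norm_diagonal _ hi
  · refine (norm_diagonal_le_iff (norm_nonneg _)).2 fun i hi => ?_
    rw [← h]; exact normFun_le_norm_diagonal _ hi

theorem eq_zero_of_mem_closure_span {X F : Type*} [NormedAddCommGroup X] [NormedSpace ℝ X]
    [NormedAddCommGroup F] [NormedSpace ℝ F] {x : ℕ → X} (g : X →L[ℝ] F) (hg : ∀ k, g (x k) = 0)
    {y : X} (hy : y ∈ (Submodule.span ℝ (Set.range x)).topologicalClosure) : g y = 0 := by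
  have h : (Submodule.span ℝ (Set.range x)).topologicalClosure ≤ LinearMap.ker g.toLinearMap := by
    refine Submodule.topologicalClosure_minimal _ (Submodule.span_le.2 ?_) g.isClosed_ker
    rintro _ ⟨k, rfl⟩
    exact hg k
  exact h hy

/-- On the closed span all components in A carry the same sequence and the others vanish.
Coordinates read in one fixed component of A therefore serve for all, and the expansion converges
summand by summand. -/
theorem isBasicSequence_diagonal (hA : A.Nonempty) :
    IsBasicSequence fun k => diagonal w A (Finsupp.single k 1) := by
  obtain ⟨i₀, hi₀⟩ := hA
  set x : ℕ → ∀ i, LorentzSpace (w i) := fun k => diagonal w A (Finsupp.single k 1) with hx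
  let Y := (Submodule.span ℝ (Set.range x)).topologicalClosure
  have hmem : ∀ k, x k ∈ Y := fun k =>
    Submodule.le_topologicalClosure _ (Submodule.subset_span ⟨k, rfl⟩)
  have hxA : ∀ k, ∀ i ∈ A, x k i = LorentzSpace.ofFinsupp (w i) (Finsupp.single k 1) :=
    fun k i hi => diagonal_of_mem _ hi
  have hcoord : ∀ y ∈ Y, ∀ i ∈ A, ∀ k, (y i).seq k = (y i₀).seq k := by
    intro y hy i hi k
    have h := eq_zero_of_mem_closure_span
      ((LorentzSpace.coord (w i) k).comp (ContinuousLinearMap.proj i) -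
        (LorentzSpace.coord (w i₀) k).comp (ContinuousLinearMap.proj i₀))
      (fun l => by
        simp [hx, diagonal_of_mem _ hi, diagonal_of_mem _ hi₀, LorentzSpace.coord_apply,
          LorentzSpace.seq_ofFinsupp]) hy
    exact sub_eq_zero.1 h
  have hzero : ∀ y ∈ Y, ∀ i ∉ A, y i = 0 := fun y hy i hi =>
    eq_zero_of_mem_closure_span (ContinuousLinearMap.proj i)
      (fun l => diagonal_of_notMem _ hi) hy
  refine ⟨{
    basis := fun k => ⟨x k, hmem k⟩
    coord := fun k => ((LorentzSpace.coord (w i₀) k).comp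
      (ContinuousLinearMap.proj i₀)).comp Y.subtypeL
    ortho := fun k l => ?_
    expansion := fun y => ?_ }, fun k => rfl⟩
  · change (x l i₀).seq k = _
    rw [hxA l i₀ hi₀, LorentzSpace.seq_ofFinsupp]
    rw [Finsupp.single_eq_pi_single]
    congr!
  · rw [HasSum, SummationFilter.conditional_filter_eq_map_range, tendsto_map'_iff,
      tendsto_subtype_rng, tendsto_pi_nhds]
    intro i
    have hval : ∀ n, ((∑ k ∈ Finset.range n, ((y : ∀ i, LorentzSpace (w i)) i₀).seq k •
        (⟨x k, hmem k⟩ : Y) : Y) : ∀ i, LorentzSpace (w i)) i =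
        ∑ k ∈ Finset.range n, ((y : ∀ i, LorentzSpace (w i)) i₀).seq k • x k i := by
      intro n
      rw [Submodule.coe_sum, Finset.sum_apply]
      rfl
    refine Tendsto.congr (fun n => (hval n).symm) ?_
    by_cases hi : i ∈ A
    · refine (LorentzSpace.tendsto_sum_coord ((y : ∀ i, LorentzSpace (w i)) i)).congr fun n => ?_
      refine Finset.sum_congr rfl fun k _ => ?_
      rw [hcoord y y.2 i hi k, hxA k i hi]
    · rw [hzero y y.2 i hi]
      refine tendsto_const_nhds.congr fun n => ?_
      refine (Finset.sum_eq_zero fun k _ => ?_).symm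
      rw [show x k i = 0 from diagonal_of_notMem _ hi, smul_zero]

theorem isWeaklyNull_diagonal : IsWeaklyNull fun k => diagonal w A (Finsupp.single k 1) := by
  classical
  intro f
  have h : ∀ k, f (diagonal w A (Finsupp.single k 1)) =
      ∑ i ∈ A, f (Pi.single i (LorentzSpace.ofFinsupp (w i) (Finsupp.single k 1))) := by
    intro k
    rw [← map_sum]
    congr 1
    funext i
    rw [Finset.sum_apply]
    by_cases hi : i ∈ A
    · rw [diagonal_of_mem _ hi, Finset.sum_eq_single_of_mem i hi, Pi.single_eq_same]
      intro j _ hj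
      rw [Pi.single_eq_of_ne hj.symm]
    · rw [diagonal_of_notMem _ hi]
      refine (Finset.sum_eq_zero fun j hj => ?_).symm
      rw [Pi.single_eq_of_ne]
      rintro rfl
      exact hi hj
  simp only [h]
  rw [← Finset.sum_const_zero (s := A)]
  refine tendsto_finsetSum A fun i _ => ?_
  exact LorentzSpace.isWeaklyNull_ofFinsupp_single
    (f.comp (ContinuousLinearMap.single ℝ (fun i => LorentzSpace (w i)) i))

/-- The spreading model generated by the diagonal unit vectors in the coordinates `i ∈ A`. -/
def diagonalModel (w : ι → LorentzWeight) (A : Finset ι) (hA : A.Nonempty) :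
    WeakSpreadingModel (∀ i, LorentzSpace (w i)) where
  toSeminorm := (normSeminorm ℝ _).comp (diagonal w A)
  exists_generating := by
    refine ⟨fun k => diagonal w A (Finsupp.single k 1), norm_diagonal_single hA,
      isBasicSequence_diagonal hA, isWeaklyNull_diagonal, fun _ => 0, antitone_const,
      tendsto_const_nhds, fun n a k _ hk _ => ?_⟩
    have h : ‖∑ i : Fin n, a i • diagonal w A (Finsupp.single (k i) 1)‖ =
        ‖diagonal w A (∑ i : Fin n, Finsupp.single (i : ℕ) (a i))‖ := by
      rw [norm_diagonal_congr fun i => (LorentzWeight.normFun_sum_single a hk.injective).symm]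
      congr 1
      rw [map_sum]
      refine Finset.sum_congr rfl fun i _ => ?_
      rw [← map_smul, Finsupp.smul_single, smul_eq_mul, mul_one]
    simp only [add_zero, inv_one, one_mul]
    exact ⟨h.ge, h.le⟩

theorem diagonalModel_apply (hA : A.Nonempty) (a : ℕ →₀ ℝ) :
    (diagonalModel w A hA).toSeminorm a = ‖diagonal w A a‖ := rfl

end CanonicalModels

/-! ### Every model is diagonal -/

section Classification

variable {ι : Type*} {w : ι → LorentzWeight}

theorem exists_bound_of_finsupp (a : ℕ →₀ ℝ) : ∃ n, ∀ k, n ≤ k → a k = 0 := by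
  refine ⟨a.support.sup id + 1, fun k hk => Finsupp.notMem_support_iff.1 fun h => ?_⟩
  have := Finset.le_sup (f := id) h
  simp only [id] at this
  omega

theorem sum_apply_smul {n : ℕ} (a : ℕ → ℝ) (x : ℕ → ∀ i, LorentzSpace (w i)) (φ : ℕ → ℕ) (i : ι) :
    (∑ j ∈ Finset.range n, a j • x (φ j)) i = ∑ j ∈ Finset.range n, a j • x (φ j) i := by
  rw [Finset.sum_apply]; rfl

variable [Fintype ι]

/-- Every spreading model generated by a weakly null sequence in a finite sum of Lorentz spaces is
equivalent to a diagonal one. -/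
theorem exists_equivalent_diagonalModel
    (hw : ∀ i m g, (w i).fundamental (m * g) ≤ (w i).fundamental m * (w i).fundamental g)
    (N : WeakSpreadingModel (∀ i, LorentzSpace (w i))) :
    ∃ (A : Finset ι) (hA : A.Nonempty), N ≤ diagonalModel w A hA ∧ diagonalModel w A hA ≤ N := by
  classical
  obtain ⟨N, x, hx1, -, hxnull, hgen⟩ := N
  obtain ⟨C, hC, hbd⟩ := hgen.exists_bounds
  have hxi : ∀ k i, ‖x k i‖ ≤ 1 := fun k i => (norm_le_pi_norm (x k) i).trans (hx1 k).le
  have hnull : ∀ i, IsWeaklyNull fun k => x k i := fun i f =>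
    hxnull (f.comp (ContinuousLinearMap.proj i))
  set A : Finset ι := Finset.univ.filter fun i =>
    ∃ δ > 0, ∃ᶠ k in atTop, ∃ p, δ ≤ |(x k i).seq p| with hA
  -- For i outside A, eventually every entry is below δ, so the vector coincides with its small
  -- part.
  have hsmall : ∀ i ∉ A, Tendsto (fun k => ‖x k i‖) atTop (𝓝 0) := by
    intro i hi
    rw [hA, Finset.mem_filter] at hi
    push Not at hi
    rw [Metric.tendsto_nhds]
    intro ε hε
    obtain ⟨δ, hδ, hle⟩ := LorentzSpace.exists_normFun_smallPart_le (hnull i) (half_pos hε)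
    filter_upwards [hi (Finset.mem_univ i) δ hδ] with k hk
    rw [Real.dist_eq, sub_zero, abs_norm]
    have : LorentzWeight.smallPart δ (x k i).seq = (x k i).seq := by
      funext p
      rw [LorentzWeight.smallPart, if_pos (hk p).le]
    have h2 := hle k
    rw [this, ← LorentzSpace.norm_eq_normFun] at h2
    linarith
  -- Otherwise all components, hence the vectors, would tend to zero in norm, although they are
  -- normalized.
  have hAne : A.Nonempty := by
    by_contra hne
    rw [Finset.not_nonempty_iff_eq_empty] at hne
    have h1 : ∀ᶠ k in atTop, ∀ i, ‖x k i‖ ≤ 1 / 2 := eventually_all.2 fun i =>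
      (hsmall i (by simp [hne])).eventually_le_const (by norm_num)
    obtain ⟨k, hk⟩ := h1.exists
    have := (pi_norm_le_iff_of_nonneg (by norm_num)).2 hk
    rw [hx1 k] at this
    norm_num at this
  refine ⟨A, hAne, ⟨C * 4, fun a => ?_⟩, ?_⟩
  · rw [diagonalModel_apply]
    obtain ⟨n, hn⟩ := exists_bound_of_finsupp a
    change N a ≤ _
    have key : ∀ η > 0, N a ≤ C * (4 * ‖diagonal w A a‖ + η) := by
      intro η hη
      set T := ∑ j ∈ Finset.range n, |a j| with hT
      have hT0 : 0 ≤ T := Finset.sum_nonneg fun _ _ => abs_nonneg _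
      have h1 : ∀ᶠ k in atTop, ∀ i, i ∉ A → ‖x k i‖ ≤ η / (T + 1) := eventually_all.2 fun i => by
        by_cases hi : i ∈ A
        · exact Eventually.of_forall fun k h => absurd hi h
        · filter_upwards [(hsmall i hi).eventually_le_const
            (show 0 < η / (T + 1) by positivity)] with k hk _ using hk
      obtain ⟨K, hK⟩ := eventually_atTop.1 h1
      obtain ⟨φ, hφ, hφK, hle⟩ := exists_norm_sum_le hw hxi hnull hn hη (max n K)
      refine (hbd n a hn φ hφ ((le_max_left _ _).trans hφK)).1.trans
        (mul_le_mul_of_nonneg_left ?_ hC.le)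
      rw [pi_norm_le_iff_of_nonneg (by positivity)]
      intro i
      rw [sum_apply_smul]
      by_cases hi : i ∈ A
      · have := normFun_le_norm_diagonal (w := w) a hi
        linarith [hle i]
      · have h2 : ‖∑ j ∈ Finset.range n, a j • x (φ j) i‖ ≤ T * (η / (T + 1)) := by
          refine (norm_sum_le _ _).trans ?_
          rw [hT, Finset.sum_mul]
          refine Finset.sum_le_sum fun j _ => ?_
          rw [norm_smul, Real.norm_eq_abs]
          exact mul_le_mul_of_nonneg_left (hK (φ j) ((le_max_right _ _).trans
            (hφK.trans (hφ.monotone (Nat.zero_le j)))) i hi) (abs_nonneg _)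
        have h3 : T * (η / (T + 1)) ≤ η := by
          rw [mul_div_assoc', div_le_iff₀ (by positivity)]
          nlinarith
        have := norm_nonneg (diagonal w A a)
        linarith
    have hlim : Tendsto (fun η : ℝ => C * (4 * ‖diagonal w A a‖ + η)) (𝓝[>] 0)
        (𝓝 (C * (4 * ‖diagonal w A a‖ + 0))) :=
      ((tendsto_id.const_add _).const_mul C).mono_left nhdsWithin_le_nhds
    have := ge_of_tendsto hlim (by filter_upwards [self_mem_nhdsWithin] with η hη using key η hη)
    linarith
  · have hδ : ∀ i ∈ A, ∃ δ > 0, ∃ᶠ k in atTop, ∃ p, δ ≤ |(x k i).seq p| := fun i hi =>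
      (Finset.mem_filter.1 hi).2
    choose! δ hδ0 hδ using hδ
    -- The sum is a convenient upper bound for the maximum of the constants over A.
    refine ⟨∑ i ∈ A, (δ i)⁻¹ * C, fun a => ?_⟩
    obtain ⟨n, hn⟩ := exists_bound_of_finsupp a
    rw [diagonalModel_apply]
    change _ ≤ _ * N a
    have hterm : ∀ i ∈ A, 0 ≤ (δ i)⁻¹ * C := fun i hi =>
      mul_nonneg (inv_nonneg.2 (hδ0 i hi).le) hC.le
    refine (norm_diagonal_le_iff
      (mul_nonneg (Finset.sum_nonneg hterm) (apply_nonneg _ _))).2 fun i hi => ?_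
    have h1 : δ i * (w i).normFun a ≤ C * N a := by
      refine le_of_forall_pos_le_add fun η hη => ?_
      obtain ⟨φ, hφ, hφn, hle⟩ := LorentzSpace.exists_le_norm_sum
        (LorentzSpace.tendsto_seq_of_isWeaklyNull (hnull i)) (hδ0 i hi) (hδ i hi) hn hη n
      refine hle.trans (add_le_add_left (le_trans ?_ (hbd n a hn φ hφ hφn).2) η)
      rw [← sum_apply_smul]
      exact norm_le_pi_norm _ i
    have h2 : (w i).normFun a ≤ (δ i)⁻¹ * C * N a := by
      rw [mul_assoc, le_inv_mul_iff₀ (hδ0 i hi)]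
      exact h1
    refine h2.trans (mul_le_mul_of_nonneg_right ?_ (apply_nonneg _ _))
    exact Finset.single_le_sum hterm hi

theorem diagonalModel_mono {A B : Finset ι} (hA : A.Nonempty) (hB : B.Nonempty) (h : A ⊆ B) :
    diagonalModel w A hA ≤ diagonalModel w B hB := by
  refine ⟨1, fun a => ?_⟩
  rw [one_mul, diagonalModel_apply, diagonalModel_apply]
  exact (norm_diagonal_le_iff (norm_nonneg _)).2 fun i hi => normFun_le_norm_diagonal _ (h hi)

/-- Test the domination on the indicator of {0, …, m − 1}, whose norm in d(w_j, 1) is Φ_j(m). -/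
theorem exists_fundamental_le_of_diagonalModel_le {A B : Finset ι} {hA : A.Nonempty}
    {hB : B.Nonempty} (h : diagonalModel w A hA ≤ diagonalModel w B hB) :
    ∃ C, ∀ i ∈ A, ∀ m,
      (w i).fundamental m ≤ C * B.sup' hB fun j => (w j).fundamental m := by
  obtain ⟨C, hC⟩ := h
  refine ⟨|C|, fun i hi m => ?_⟩
  set a : ℕ →₀ ℝ := ∑ k ∈ Finset.range m, Finsupp.single k 1 with ha
  have haapp : ∀ p, a p = if p < m then 1 else 0 := by
    intro p
    rw [ha, Finsupp.finsetSum_apply]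
    simp only [Finsupp.single_apply, Finset.sum_ite_eq', Finset.mem_range]
  have h1 : (w i).fundamental m ≤ (w i).normFun a := by
    have := LorentzWeight.fundamental_le_normFun (w := w i) ((w i).mem_finsupp a)
      (F := Finset.range m) fun k hk => by rw [haapp, if_pos (Finset.mem_range.1 hk), abs_one]
    simpa using this
  have h2 : ∀ j, (w j).normFun a ≤ (w j).fundamental m := by
    intro j
    have := LorentzWeight.normFun_le_fundamental (w := w j) (a := a) (F := Finset.range m)
      (fun k hk => by rw [haapp, if_neg (by simpa using hk)])
      fun k => by rw [haapp]; split_ifs <;> simp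
    simpa using this
  have h3 := hC a
  rw [diagonalModel_apply, diagonalModel_apply] at h3
  have hsup : ‖diagonal w B a‖ ≤ B.sup' hB fun j => (w j).fundamental m := by
    obtain ⟨j₀, hj₀⟩ := hB
    refine (norm_diagonal_le_iff (((w j₀).fundamental_nonneg m).trans
      (Finset.le_sup' (fun j => (w j).fundamental m) hj₀))).2 fun j hj => (h2 j).trans ?_
    exact Finset.le_sup' (fun j => (w j).fundamental m) hj
  calc (w i).fundamental m ≤ (w i).normFun a := h1
    _ ≤ ‖diagonal w A a‖ := normFun_le_norm_diagonal a hi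
    _ ≤ C * ‖diagonal w B a‖ := h3
    _ ≤ |C| * ‖diagonal w B a‖ := mul_le_mul_of_nonneg_right (le_abs_self C) (norm_nonneg _)
    _ ≤ _ := mul_le_mul_of_nonneg_left hsup (abs_nonneg C)

end Classification

/-! ### Domination is inclusion -/

section IncomparableFamily

variable {S : ℕ → ℝ → ℝ}

/-- The case m = 0 is excluded: the empty sum is 0, while the value of `S i` at 0 is unrestricted.
-/
theorem IsIncomparableFamily.fundamental_weight (hS : IsIncomparableFamily S) (i : ℕ) {m : ℕ}
    (hm : 1 ≤ m) : (hS.weight i).fundamental m = S i m := by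
  obtain ⟨m, rfl⟩ : ∃ l, m = l + 1 := ⟨m - 1, by omega⟩
  push_cast
  exact sum_weightSeq (S i) m

theorem IsIncomparableFamily.fundamental_weight_mul_le (hS : IsIncomparableFamily S) (i m g : ℕ) :
    (hS.weight i).fundamental (m * g) ≤
      (hS.weight i).fundamental m * (hS.weight i).fundamental g := by
  rcases Nat.eq_zero_or_pos m with rfl | hm
  · simp [LorentzWeight.fundamental]
  rcases Nat.eq_zero_or_pos g with rfl | hg
  · simp [LorentzWeight.fundamental]
  rw [hS.fundamental_weight i hm, hS.fundamental_weight i hg,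
    hS.fundamental_weight i (Nat.mul_pos hm hg), Nat.cast_mul]
  exact (hS.submultiplicative i).map_mul_le m g (by exact_mod_cast hm) (by exact_mod_cast hg)

theorem IsIncomparableFamily.diagonalModel_le_iff (hS : IsIncomparableFamily S) {n : ℕ}
    {A B : Finset (Fin n)} (hA : A.Nonempty) (hB : B.Nonempty) :
    diagonalModel (fun i : Fin n => hS.weight i) A hA ≤
      diagonalModel (fun i : Fin n => hS.weight i) B hB ↔ A ⊆ B := by
  refine ⟨fun h i hi => ?_, diagonalModel_mono hA hB⟩
  by_contra hiB
  obtain ⟨C, hC⟩ := exists_fundamental_le_of_diagonalModel_le h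
  have hB' : (B.map Fin.valEmbedding).Nonempty := hB.map
  obtain ⟨m, hm, hlt⟩ := hS.incomparable (B.map Fin.valEmbedding) hB' i (by
    rw [Finset.mem_map]
    rintro ⟨j, hj, hji⟩
    rw [Fin.valEmbedding_apply] at hji
    exact hiB (Fin.ext hji ▸ hj)) C
  have h1 := hC i hi m
  rw [hS.fundamental_weight i hm] at h1
  have h2 : (B.sup' hB fun j => (hS.weight j).fundamental m) ≤
      (B.map Fin.valEmbedding).sup' hB' fun i => S i m := by
    rw [Finset.sup'_map]
    refine Finset.sup'_le _ _ fun j hj => ?_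
    rw [hS.fundamental_weight j hm]
    exact Finset.le_sup' (f := (fun i => S i (m : ℝ)) ∘ Fin.valEmbedding) hj
  have hC0 : 0 < S i m := by
    rw [← hS.fundamental_weight i hm]
    exact Finset.sum_pos (fun k _ => (hS.weight i).pos k) ⟨0, Finset.mem_range.2 hm⟩
  have hpos : 0 < (B.map Fin.valEmbedding).sup' hB' fun i => S i m := by
    obtain ⟨j, hj⟩ := hB
    have h3 : 0 < S j m := by
      rw [← hS.fundamental_weight j hm]
      exact Finset.sum_pos (fun k _ => (hS.weight j).pos k) ⟨0, Finset.mem_range.2 hm⟩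
    exact h3.trans_le (Finset.le_sup' (fun i => S i (m : ℝ))
      (Finset.mem_map_of_mem Fin.valEmbedding hj))
  rw [lt_div_iff₀ hpos] at hlt
  -- C is only some real constant; a negative one would contradict the positivity of `S i m`.
  rcases le_or_gt 0 C with h0 | h0
  · exact absurd (h1.trans (mul_le_mul_of_nonneg_left h2 h0)) hlt.not_ge
  · obtain ⟨j, hj⟩ := hB
    have h4 : 0 ≤ B.sup' ⟨j, hj⟩ fun j => (hS.weight j).fundamental m :=
      ((hS.weight j).fundamental_nonneg m).trans
        (Finset.le_sup' (fun j : Fin n => (hS.weight j).fundamental m) hj)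
    nlinarith [mul_nonpos_of_nonpos_of_nonneg h0.le h4]

theorem IsIncomparableFamily.nonempty_orderIso (hS : IsIncomparableFamily S) (n : ℕ) :
    Nonempty (SPw (LorentzSum hS.weight n) ≃o {A : Finset (Fin n) // A.Nonempty}) := by
  let f : {A : Finset (Fin n) // A.Nonempty} → SPw (LorentzSum hS.weight n) := fun A =>
    toAntisymmetrization (· ≤ ·) (diagonalModel (fun i : Fin n => hS.weight i) A.1 A.2)
  have hf : ∀ A B, f A ≤ f B ↔ A ≤ B := fun A B =>
    toAntisymmetrization_le_toAntisymmetrization_iff.trans (hS.diagonalModel_le_iff A.2 B.2)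
  refine ⟨(RelIso.ofSurjective (OrderEmbedding.ofMapLEIff f hf) ?_).symm⟩
  intro q
  induction q using Antisymmetrization.ind with
  | _ N =>
    obtain ⟨A, hA, h1, h2⟩ := exists_equivalent_diagonalModel
      (w := fun i : Fin n => hS.weight i) (fun i => hS.fundamental_weight_mul_le i) N
    exact ⟨⟨A, hA⟩, Quotient.sound ⟨h2, h1⟩⟩

end IncomparableFamily

/-! ### Submultiplicative functions from dyadic sums -/

section DyadicSums

/-- Positive sequences `c` with `c (k + 1) / c k ∈ [6 / 5, 36 / 25]` that are submultiplicative on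
`(ℕ, +)`. -/
structure IsDyadicSymbol (c : ℕ → ℝ) : Prop where
  one_le : 1 ≤ c 0
  zero_le : c 0 ≤ 6 / 5
  le_succ : ∀ k, 6 / 5 * c k ≤ c (k + 1)
  succ_le : ∀ k, c (k + 1) ≤ 36 / 25 * c k
  add_le : ∀ k l, c (k + l) ≤ c k * c l

/-- The concave function `∑ c_k min(1, x / 2 ^ k)`. -/
def dyadicSum (c : ℕ → ℝ) (x : ℝ) : ℝ := ∑' k, c k * min 1 (x / 2 ^ k)

namespace IsDyadicSymbol

variable {c : ℕ → ℝ}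

theorem one_le_apply (h : IsDyadicSymbol c) (k : ℕ) : 1 ≤ c k := by
  induction k with
  | zero => exact h.one_le
  | succ k ih => linarith [h.le_succ k]

theorem pos (h : IsDyadicSymbol c) (k : ℕ) : 0 < c k := by linarith [h.one_le_apply k]

theorem apply_add_le (h : IsDyadicSymbol c) (m k : ℕ) : c (k + m) ≤ c m * (36 / 25) ^ k := by
  induction k with
  | zero => simp
  | succ k ih =>
    have := h.succ_le (k + m)
    rw [show k + 1 + m = k + m + 1 by ring, pow_succ]
    linarith

/-- Growth by at least 6/5 makes the sum geometric; the induction closes because 6 + 1 ≤ 6 · 6/5. -/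
theorem sum_range_le (h : IsDyadicSymbol c) (m : ℕ) : ∑ k ∈ Finset.range m, c k ≤ 6 * c m := by
  induction m with
  | zero => simpa using (h.pos 0).le
  | succ m ih =>
    rw [Finset.sum_range_succ]
    linarith [h.le_succ m, h.pos m]

theorem div_add_le (h : IsDyadicSymbol c) (m k : ℕ) :
    c (k + m) / 2 ^ (k + m) ≤ c m / 2 ^ m * (18 / 25) ^ k := by
  have h1 := h.apply_add_le m k
  rw [div_le_iff₀ (by positivity)]
  calc _ ≤ _ := h1
    _ = _ := by
      rw [show (36 / 25 : ℝ) = 18 / 25 * 2 by norm_num, mul_pow, pow_add]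
      field_simp

theorem summable_div_add (h : IsDyadicSymbol c) (m : ℕ) :
    Summable fun k => c (k + m) / 2 ^ (k + m) :=
  Summable.of_nonneg_of_le (fun k => div_nonneg (h.pos _).le (by positivity)) (h.div_add_le m)
    ((summable_geometric_of_lt_one (by norm_num) (by norm_num)).mul_left _)

theorem summable_div (h : IsDyadicSymbol c) : Summable fun k => c k / 2 ^ k :=
  h.summable_div_add 0

/-- c_k/2^k decays with ratio at most (36/25)/2 = 18/25, and 1/(1 − 18/25) = 25/7 ≤ 4. -/
theorem tsum_div_add_le (h : IsDyadicSymbol c) (m : ℕ) :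
    ∑' k, c (k + m) / 2 ^ (k + m) ≤ 4 * (c m / 2 ^ m) := by
  have hgeo : Summable fun k : ℕ => (18 / 25 : ℝ) ^ k :=
    summable_geometric_of_lt_one (by norm_num) (by norm_num)
  refine ((h.summable_div_add m).tsum_le_tsum (h.div_add_le m) (hgeo.mul_left _)).trans ?_
  rw [tsum_mul_left, tsum_geometric_of_lt_one (by norm_num) (by norm_num), mul_comm]
  refine mul_le_mul_of_nonneg_right (by norm_num) (div_nonneg (h.pos m).le (by positivity))

theorem summable (h : IsDyadicSymbol c) (x : ℝ) : Summable fun k => c k * min 1 (x / 2 ^ k) := by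
  refine Summable.of_norm_bounded (h.summable_div.mul_left |x|) fun k => ?_
  have h2 : (0 : ℝ) < 2 ^ k := by positivity
  rw [Real.norm_eq_abs, abs_mul, abs_of_pos (h.pos k), mul_div_left_comm]
  refine mul_le_mul_of_nonneg_left ?_ (h.pos k).le
  have h0 : 0 ≤ |x| / 2 ^ k := by positivity
  rw [abs_le]
  constructor
  · refine le_min (by linarith) ?_
    rw [← neg_div]
    exact div_le_div_of_nonneg_right (neg_abs_le x) h2.le
  · exact (min_le_right _ _).trans (div_le_div_of_nonneg_right (le_abs_self x) h2.le)

theorem monotone (h : IsDyadicSymbol c) : Monotone (dyadicSum c) := fun x y hxy =>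
  (h.summable x).tsum_le_tsum (fun k => mul_le_mul_of_nonneg_left
    (min_le_min_left 1 (div_le_div_of_nonneg_right hxy (by positivity))) (h.pos k).le) (h.summable y)

theorem strictMono (h : IsDyadicSymbol c) : StrictMono (dyadicSum c) := by
  intro x y hxy
  obtain ⟨m, hm⟩ := pow_unbounded_of_one_lt y (one_lt_two : (1 : ℝ) < 2)
  have h2 : (0 : ℝ) < 2 ^ m := by positivity
  refine Summable.tsum_lt_tsum (i := m) (fun k => mul_le_mul_of_nonneg_left
    (min_le_min_left 1 (div_le_div_of_nonneg_right hxy.le (by positivity))) (h.pos k).le) ?_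
    (h.summable x) (h.summable y)
  rw [min_eq_right ((div_le_one h2).2 (hxy.trans hm).le), min_eq_right ((div_le_one h2).2 hm.le)]
  exact mul_lt_mul_of_pos_left (div_lt_div_of_pos_right hxy h2) (h.pos m)

theorem concaveOn (h : IsDyadicSymbol c) : ConcaveOn ℝ Set.univ (dyadicSum c) := by
  refine ⟨convex_univ, fun x _ y _ a b ha hb hab => ?_⟩
  simp only [smul_eq_mul, dyadicSum]
  rw [← tsum_mul_left, ← tsum_mul_left, ← ((h.summable x).mul_left a).tsum_add
    ((h.summable y).mul_left b)]
  refine (((h.summable x).mul_left a).add ((h.summable y).mul_left b)).tsum_le_tsum (fun k => ?_)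
    (h.summable _)
  have h1 : a * min 1 (x / 2 ^ k) + b * min 1 (y / 2 ^ k) ≤ min 1 ((a * x + b * y) / 2 ^ k) := by
    refine le_min ?_ ?_
    · nlinarith [min_le_left 1 (x / 2 ^ k), min_le_left 1 (y / 2 ^ k)]
    · rw [add_div, mul_div_assoc, mul_div_assoc]
      exact add_le_add (mul_le_mul_of_nonneg_left (min_le_right _ _) ha)
        (mul_le_mul_of_nonneg_left (min_le_right _ _) hb)
  nlinarith [mul_le_mul_of_nonneg_left h1 (h.pos k).le]

theorem continuous (h : IsDyadicSymbol c) : Continuous (dyadicSum c) := by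
  have hK : 0 ≤ ∑' k, c k / 2 ^ k := tsum_nonneg fun k => div_nonneg (h.pos k).le (by positivity)
  refine (LipschitzWith.of_le_add_mul (∑' k, c k / 2 ^ k).toNNReal fun x y => ?_).continuous
  simp only [dyadicSum]
  rw [Real.coe_toNNReal _ hK, ← tsum_mul_right, ← (h.summable y).tsum_add (h.summable_div.mul_right _)]
  refine (h.summable x).tsum_le_tsum (fun k => ?_) ((h.summable y).add (h.summable_div.mul_right _))
  rw [div_mul_eq_mul_div, mul_div_assoc, ← mul_add]
  refine mul_le_mul_of_nonneg_left ?_ (h.pos k).le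
  have h2 : (0 : ℝ) < 2 ^ k := by positivity
  have h0 : 0 ≤ dist x y / 2 ^ k := by positivity
  have h1 : x / 2 ^ k ≤ y / 2 ^ k + dist x y / 2 ^ k := by
    rw [← add_div]
    refine div_le_div_of_nonneg_right ?_ h2.le
    rw [Real.dist_eq]
    linarith [le_abs_self (x - y)]
  rcases le_total 1 (y / 2 ^ k) with hy | hy
  · rw [min_eq_left hy]
    exact (min_le_left _ _).trans (by linarith)
  · rw [min_eq_right hy]
    exact (min_le_right _ _).trans h1

/-- Termwise min(1, rt) ≤ r min(1, t). So T(x)/x is nonincreasing for x > 0, which handles both the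
crossing with the identity and the mixed cases of submultiplicativity. -/
theorem dyadicSum_mul_le (h : IsDyadicSymbol c) {r x : ℝ} (hr : 1 ≤ r) (hx : 0 ≤ x) :
    dyadicSum c (r * x) ≤ r * dyadicSum c x := by
  simp only [dyadicSum]
  rw [← tsum_mul_left]
  refine (h.summable _).tsum_le_tsum (fun k => ?_) ((h.summable x).mul_left r)
  rw [mul_left_comm]
  refine mul_le_mul_of_nonneg_left ?_ (h.pos k).le
  have h0 : 0 ≤ x / 2 ^ k := by positivity
  rw [mul_min_of_nonneg _ _ (by linarith), mul_one, mul_div_assoc]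
  exact min_le_min_right _ hr

/-- Between 2^m and 2^(m+1) the terms with k ≤ m are saturated and the later ones are linear. -/
theorem dyadicSum_eq (h : IsDyadicSymbol c) {m : ℕ} {x : ℝ} (h1 : 2 ^ m ≤ x) (h2 : x ≤ 2 ^ (m + 1)) :
    dyadicSum c x = (∑' k, c (k + (m + 1)) / 2 ^ (k + (m + 1))) * x +
      ∑ k ∈ Finset.range (m + 1), c k := by
  rw [dyadicSum, ← (h.summable x).sum_add_tsum_nat_add (m + 1), add_comm, ← tsum_mul_right]
  congr 1
  · refine tsum_congr fun k => ?_
    have hp : (2 : ℝ) ^ (m + 1) ≤ 2 ^ (k + (m + 1)) :=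
      pow_le_pow_right₀ one_le_two (Nat.le_add_left _ _)
    rw [min_eq_right ((div_le_one (by positivity)).2 (h2.trans hp))]
    ring
  · refine Finset.sum_congr rfl fun k hk => ?_
    have hp : (2 : ℝ) ^ k ≤ 2 ^ m :=
      pow_le_pow_right₀ one_le_two (Nat.lt_succ_iff.1 (Finset.mem_range.1 hk))
    rw [min_eq_left ((one_le_div (by positivity)).2 (hp.trans h1)), mul_one]

theorem le_dyadicSum (h : IsDyadicSymbol c) {m : ℕ} {x : ℝ} (hx : 2 ^ m ≤ x) :
    c m ≤ dyadicSum c x := by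
  have h0 : 0 ≤ x := le_trans (by positivity) hx
  have := (h.summable x).le_tsum m fun k _ =>
    mul_nonneg (h.pos k).le (le_min zero_le_one (by positivity))
  rwa [min_eq_left ((one_le_div (by positivity)).2 hx), mul_one] at this

/-- Saturated terms grow geometrically up to m (at most 6c_m) and linear terms decay geometrically
from m on (at most 4c_m). -/
theorem dyadicSum_pow_le (h : IsDyadicSymbol c) (m : ℕ) : dyadicSum c (2 ^ m) ≤ 10 * c m := by
  rw [dyadicSum, ← (h.summable _).sum_add_tsum_nat_add m]
  have h1 : ∑ k ∈ Finset.range m, c k * min 1 (2 ^ m / 2 ^ k) ≤ 6 * c m :=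
    (Finset.sum_le_sum fun k _ => mul_le_of_le_one_right (h.pos k).le (min_le_left _ _)).trans
      (h.sum_range_le m)
  have h2 : ∑' k, c (k + m) * min 1 (2 ^ m / 2 ^ (k + m)) ≤ 4 * c m := by
    calc _ ≤ ∑' k, 2 ^ m * (c (k + m) / 2 ^ (k + m)) := by
          refine ((summable_nat_add_iff m).2 (h.summable (2 ^ m))).tsum_le_tsum (fun k => ?_)
            ((h.summable_div_add m).mul_left _)
          rw [mul_div_left_comm]
          exact mul_le_mul_of_nonneg_left (min_le_right _ _) (h.pos _).le
      _ = 2 ^ m * ∑' k, c (k + m) / 2 ^ (k + m) := tsum_mul_left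
      _ ≤ 2 ^ m * (4 * (c m / 2 ^ m)) :=
          mul_le_mul_of_nonneg_left (h.tsum_div_add_le m) (by positivity)
      _ = 4 * c m := by field_simp
  linarith

/-- With 2^m ≤ x < 2^(m+1) and 2^l ≤ y < 2^(l+1), rounding costs two steps of c and the comparison
of T with c costs 10, in all 10 · (36/25)² < 21. -/
theorem dyadicSum_mul_le_mul (h : IsDyadicSymbol c) {x y : ℝ} (hx : 1 ≤ x) (hy : 1 ≤ y) :
    dyadicSum c (x * y) ≤ 21 * (dyadicSum c x * dyadicSum c y) := by
  obtain ⟨m, hm1, hm2⟩ := exists_nat_pow_near hx one_lt_two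
  obtain ⟨l, hl1, hl2⟩ := exists_nat_pow_near hy one_lt_two
  have h1 : x * y ≤ 2 ^ (m + l + 2) := by
    calc x * y ≤ 2 ^ (m + 1) * 2 ^ (l + 1) :=
          mul_le_mul hm2.le hl2.le (by linarith) (by positivity)
      _ = _ := by ring
  have h2 : c (m + l + 2) ≤ 36 / 25 * (36 / 25 * (c m * c l)) :=
    (h.succ_le _).trans (mul_le_mul_of_nonneg_left ((h.succ_le _).trans
      (mul_le_mul_of_nonneg_left (h.add_le m l) (by norm_num))) (by norm_num))
  have h3 : c m * c l ≤ dyadicSum c x * dyadicSum c y :=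
    mul_le_mul (h.le_dyadicSum hm1) (h.le_dyadicSum hl1) (h.pos l).le
      ((h.pos m).le.trans (h.le_dyadicSum hm1))
  have h4 : 0 < c m * c l := mul_pos (h.pos m) (h.pos l)
  calc dyadicSum c (x * y) ≤ dyadicSum c (2 ^ (m + l + 2)) := h.monotone h1
    _ ≤ 10 * c (m + l + 2) := h.dyadicSum_pow_le _
    _ ≤ _ := by linarith

end IsDyadicSymbol

/-- The factor for which `x` and the multiple of `dyadicSum c x` cross at `2 ^ 20`. -/
def crossFactor (c : ℕ → ℝ) : ℝ := 2 ^ 20 / dyadicSum c (2 ^ 20)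

/-- The submultiplicative function built from `c`. -/
def dyadicFun (c : ℕ → ℝ) (x : ℝ) : ℝ := min x (crossFactor c * dyadicSum c x)

namespace IsDyadicSymbol

variable {c : ℕ → ℝ}

theorem dyadicSum_pos (h : IsDyadicSymbol c) {x : ℝ} (hx : 1 ≤ x) : 0 < dyadicSum c x :=
  (h.pos 0).trans_le (h.le_dyadicSum (by simpa using hx))

/-- This is why the crossing point is as far out as 2^20: T(2^20) is at most 10 · (6/5) ·
(36/25)^20, which is below 2^20/21. -/
theorem le_crossFactor (h : IsDyadicSymbol c) : 21 ≤ crossFactor c := by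
  rw [crossFactor, le_div_iff₀ (h.dyadicSum_pos (by norm_num))]
  have h1 := h.dyadicSum_pow_le 20
  have h2 := h.apply_add_le 0 20
  have h3 := h.zero_le
  have h4 : (36 / 25 : ℝ) ^ 20 ≤ 4000 := by norm_num
  have h5 : c 20 ≤ 6 / 5 * 4000 :=
    h2.trans (mul_le_mul h3 h4 (by positivity) (by norm_num))
  have h6 : (21 * 10 * (6 / 5 * 4000) : ℝ) ≤ 2 ^ 20 := by norm_num
  linarith

theorem crossFactor_le (h : IsDyadicSymbol c) : crossFactor c ≤ 2 ^ 20 :=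
  div_le_self (by positivity) ((h.one_le_apply 20).trans (h.le_dyadicSum le_rfl))

theorem crossFactor_mul (h : IsDyadicSymbol c) : crossFactor c * dyadicSum c (2 ^ 20) = 2 ^ 20 :=
  div_mul_cancel₀ _ (h.dyadicSum_pos (by norm_num)).ne'

/-- Since T(x)/x is nonincreasing, λT stays above the identity up to the crossing point and below it
afterwards. The minimum thus creates no breakpoint except 2^20. -/
theorem dyadicFun_of_le (h : IsDyadicSymbol c) {x : ℝ} (hx : 0 < x) (hx' : x ≤ 2 ^ 20) :
    dyadicFun c x = x := by
  refine min_eq_left ?_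
  have h1 := h.dyadicSum_mul_le ((one_le_div hx).2 hx') hx.le
  rw [div_mul_cancel₀ _ hx.ne', div_mul_eq_mul_div, le_div_iff₀ hx] at h1
  have h2 := mul_le_mul_of_nonneg_left h1 (show 0 ≤ crossFactor c by linarith [h.le_crossFactor])
  rw [← mul_assoc, h.crossFactor_mul, mul_left_comm] at h2
  exact le_of_mul_le_mul_left h2 (by positivity)

theorem dyadicFun_of_ge (h : IsDyadicSymbol c) {x : ℝ} (hx : 2 ^ 20 ≤ x) :
    dyadicFun c x = crossFactor c * dyadicSum c x := by
  refine min_eq_right ?_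
  have h0 : (0 : ℝ) < 2 ^ 20 := by positivity
  have h1 := h.dyadicSum_mul_le ((one_le_div h0).2 hx) h0.le
  rw [div_mul_cancel₀ _ h0.ne'] at h1
  refine (mul_le_mul_of_nonneg_left h1
    (show 0 ≤ crossFactor c by linarith [h.le_crossFactor])).trans ?_
  rw [mul_left_comm, h.crossFactor_mul, div_mul_cancel₀ _ h0.ne']

theorem isPiecewiseLinear_dyadicFun (h : IsDyadicSymbol c) : IsPiecewiseLinear (dyadicFun c) := by
  let t : ℕ → ℝ := fun n => Nat.casesOn n 1 fun k => 2 ^ (20 + k)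
  have ht : ∀ k, t (k + 1) = 2 ^ (20 + k) := fun k => rfl
  refine ⟨t, strictMono_nat_of_lt_succ fun n => ?_, rfl, ?_, fun n => ?_⟩
  · cases n with
    | zero => rw [ht]; change (1 : ℝ) < _; norm_num
    | succ n => rw [ht, ht]; exact pow_lt_pow_right₀ one_lt_two (by omega)
  · rw [← tendsto_add_atTop_iff_nat 1]
    refine ((tendsto_pow_atTop_atTop_of_one_lt (one_lt_two : (1 : ℝ) < 2)).comp
      (tendsto_add_atTop_nat 20)).congr fun n => ?_
    rw [ht, Function.comp_apply, add_comm]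
  · cases n with
    | zero =>
      refine ⟨1, 0, fun x hx => ?_⟩
      rw [ht] at hx
      rw [h.dyadicFun_of_le (zero_lt_one.trans_le hx.1) (by simpa using hx.2)]
      ring
    | succ n =>
      refine ⟨crossFactor c * ∑' k, c (k + (20 + n + 1)) / 2 ^ (k + (20 + n + 1)),
        crossFactor c * ∑ k ∈ Finset.range (20 + n + 1), c k, fun x hx => ?_⟩
      rw [ht, ht] at hx
      have h1 : (2 : ℝ) ^ 20 ≤ 2 ^ (20 + n) := pow_le_pow_right₀ one_le_two (by omega)
      rw [h.dyadicFun_of_ge (h1.trans hx.1), h.dyadicSum_eq hx.1 hx.2]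
      ring

theorem isSubmultiplicative_dyadicFun (h : IsDyadicSymbol c) :
    IsSubmultiplicative (dyadicFun c) where
  piecewiseLinear := h.isPiecewiseLinear_dyadicFun
  continuousOn := (continuous_id.min (continuous_const.mul h.continuous)).continuousOn
  strictMonoOn := by
    intro x _ y _ hxy
    exact min_lt_min hxy (mul_lt_mul_of_pos_left (h.strictMono hxy)
      (by linarith [h.le_crossFactor]))
  concaveOn := by
    have h1 : ConcaveOn ℝ (Set.Ici (1 : ℝ)) (fun x => crossFactor c * dyadicSum c x) :=
      (h.concaveOn.subset (Set.subset_univ _) (convex_Ici 1)).smul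
        (show 0 ≤ crossFactor c by linarith [h.le_crossFactor])
    exact (concaveOn_id (convex_Ici 1)).inf h1
  eq_self := fun x hx => h.dyadicFun_of_le (by linarith [hx.1]) (hx.2.trans (by norm_num))
  map_mul_le := by
    intro x y hx hy
    have hC : 0 < crossFactor c := by linarith [h.le_crossFactor]
    have hTx := h.dyadicSum_pos hx
    have hTy := h.dyadicSum_pos hy
    have hx0 : 0 ≤ x := by linarith
    have hy0 : 0 ≤ y := by linarith
    have h1 : dyadicSum c (x * y) ≤ x * dyadicSum c y := h.dyadicSum_mul_le hx hy0
    have h2 : dyadicSum c (x * y) ≤ dyadicSum c x * y := by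
      rw [mul_comm, mul_comm (dyadicSum c x)]; exact h.dyadicSum_mul_le hy hx0
    simp only [dyadicFun]
    -- If either minimum is the identity, xy or T(xy) ≤ xT(y) suffices; if both are λT, the factor
    -- 21 is absorbed by one of the two factors λ.
    rcases min_choice x (crossFactor c * dyadicSum c x) with e | e <;>
      rcases min_choice y (crossFactor c * dyadicSum c y) with e' | e' <;> rw [e, e']
    · exact min_le_left _ _
    · refine (min_le_right _ _).trans ?_
      rw [mul_left_comm]
      exact mul_le_mul_of_nonneg_left h1 hC.le
    · refine (min_le_right _ _).trans ?_
      rw [mul_assoc]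
      exact mul_le_mul_of_nonneg_left h2 hC.le
    · refine (min_le_right _ _).trans ?_
      rw [mul_assoc]
      refine mul_le_mul_of_nonneg_left ((h.dyadicSum_mul_le_mul hx hy).trans ?_) hC.le
      rw [mul_left_comm (dyadicSum c x)]
      exact mul_le_mul_of_nonneg_right h.le_crossFactor (mul_pos hTx hTy).le

/-- With `le_dyadicFun_pow`, growth along powers of 2 is that of c up to constants independent of c,
so incomparability can be checked on the symbols. -/
theorem dyadicFun_pow_le (h : IsDyadicSymbol c) (k : ℕ) :
    dyadicFun c (2 ^ k) ≤ 2 ^ 20 * 10 * c k := by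
  refine (min_le_right _ _).trans ?_
  rw [mul_assoc]
  exact mul_le_mul h.crossFactor_le (h.dyadicSum_pow_le k)
    (h.dyadicSum_pos (one_le_pow₀ one_le_two)).le (by positivity)

theorem le_dyadicFun_pow (h : IsDyadicSymbol c) {k : ℕ} (hk : 20 ≤ k) :
    c k ≤ dyadicFun c (2 ^ k) := by
  rw [h.dyadicFun_of_ge (pow_le_pow_right₀ one_le_two hk)]
  have h1 := h.le_dyadicSum (m := k) le_rfl
  have h2 := h.le_crossFactor
  nlinarith [h.pos k]

end IsDyadicSymbol

end DyadicSums

/-! ### Incomparable exponents -/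

section Exponents

/-- A subadditive function growing up to the height `n ^ 2` with slope `1 / (n !) ^ 2`. -/
def ramp (n k : ℕ) : ℕ := min (n ^ 2) (1 + k / n.factorial ^ 2)

theorem ramp_le (n k : ℕ) : ramp n k ≤ 1 + k :=
  (min_le_right _ _).trans (Nat.add_le_add_left (Nat.div_le_self _ _) 1)

/-- Splitting an integer quotient loses at most 1, which the summand 1 in each ramp absorbs; capping
preserves subadditivity. -/
theorem ramp_add_le (n k l : ℕ) : ramp n (k + l) ≤ ramp n k + ramp n l := by
  have hpos : 0 < n.factorial ^ 2 := by have := n.factorial_pos; positivity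
  have h : (k + l) / n.factorial ^ 2 ≤ k / n.factorial ^ 2 + l / n.factorial ^ 2 + 1 := by
    rw [Nat.add_div hpos]
    split_ifs <;> omega
  unfold ramp
  generalize (k + l) / n.factorial ^ 2 = u at h ⊢
  generalize k / n.factorial ^ 2 = v at h ⊢
  generalize l / n.factorial ^ 2 = z at h ⊢
  generalize n ^ 2 = p
  omega

theorem ramp_mono (n : ℕ) : Monotone (ramp n) := fun _ _ h =>
  min_le_min_left _ (Nat.add_le_add_left (Nat.div_le_div_right h) 1)

theorem ramp_succ_le (n k : ℕ) : ramp n (k + 1) ≤ ramp n k + 1 := by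
  have hpos : 0 < n.factorial ^ 2 := by have := n.factorial_pos; positivity
  have h : (k + 1) / n.factorial ^ 2 ≤ k / n.factorial ^ 2 + 1 := by
    rw [← Nat.add_div_right k hpos]
    exact Nat.div_le_div_right (by omega)
  unfold ramp
  omega

/-- The supremum of the ramps assigned to the index `j`. -/
def rampSup (j k : ℕ) : ℕ := ⨆ n, if n.unpair.1 = j then ramp n k else 0

/-- Needed because an unbounded supremum in ℕ would default to 0. -/
theorem bddAbove_rampSup (j k : ℕ) :
    BddAbove (Set.range fun n : ℕ => if n.unpair.1 = j then ramp n k else 0) := by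
  refine ⟨1 + k, ?_⟩
  rintro _ ⟨n, rfl⟩
  simp only
  split_ifs
  · exact ramp_le n k
  · exact Nat.zero_le _

theorem rampSup_le_iff {j k b : ℕ} :
    rampSup j k ≤ b ↔ ∀ n : ℕ, n.unpair.1 = j → ramp n k ≤ b := by
  rw [rampSup, ciSup_le_iff (bddAbove_rampSup j k)]
  refine forall_congr' fun n => ?_
  split_ifs with h <;> simp [h]

theorem ramp_le_rampSup {j n : ℕ} (h : n.unpair.1 = j) (k : ℕ) : ramp n k ≤ rampSup j k :=
  rampSup_le_iff.1 le_rfl n h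

theorem rampSup_add_le (j k l : ℕ) : rampSup j (k + l) ≤ rampSup j k + rampSup j l :=
  rampSup_le_iff.2 fun n hn => (ramp_add_le n k l).trans
    (Nat.add_le_add (ramp_le_rampSup hn k) (ramp_le_rampSup hn l))

theorem rampSup_mono (j : ℕ) : Monotone (rampSup j) := fun _ l h =>
  rampSup_le_iff.2 fun n hn => (ramp_mono n h).trans (ramp_le_rampSup hn l)

theorem rampSup_succ_le (j k : ℕ) : rampSup j (k + 1) ≤ rampSup j k + 1 :=
  rampSup_le_iff.2 fun n hn => (ramp_succ_le n k).trans
    (Nat.add_le_add_right (ramp_le_rampSup hn k) 1)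

/-- At k = n²(n!)² the ramp n has reached its top n². Ramps with smaller index are capped at (n −
1)², and those with larger index n' still have value at most 1 because k < (n'!)². So the owner of n
leads everyone else by at least n² − (n − 1)² − 1. -/
theorem exists_rampSup_add_le (j M : ℕ) :
    ∃ k, M ≤ k ∧ ∀ i, i ≠ j → rampSup i k + M ≤ rampSup j k := by
  -- The pairing gives j arbitrarily large indices of its own; n ≥ M + 2 makes the lead 2n − 2 at
  -- least M.
  set n := Nat.pair j (M + 2) with hn
  have hMn : M + 2 ≤ n := Nat.right_le_pair j (M + 2)
  have hfac : 0 < n.factorial := n.factorial_pos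
  refine ⟨n ^ 2 * n.factorial ^ 2, ?_, fun i hij => ?_⟩
  · calc M ≤ n := by omega
      _ = n * 1 := (mul_one n).symm
      _ ≤ n ^ 2 * n.factorial ^ 2 :=
        Nat.mul_le_mul (Nat.le_self_pow two_ne_zero n) (Nat.one_le_pow _ _ hfac)
  have h1 : n ^ 2 ≤ rampSup j (n ^ 2 * n.factorial ^ 2) := by
    refine le_trans ?_ (ramp_le_rampSup (j := j) (n := n) (by rw [hn, Nat.unpair_pair]) _)
    rw [ramp, Nat.mul_div_cancel _ (by positivity)]
    exact le_min le_rfl (by omega)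
  refine le_trans ?_ h1
  have h2 : rampSup i (n ^ 2 * n.factorial ^ 2) ≤ (n - 1) ^ 2 + 1 := by
    refine rampSup_le_iff.2 fun n' hn' => ?_
    rcases lt_trichotomy n' n with hlt | heq | hgt
    · refine (min_le_left _ _).trans ((Nat.pow_le_pow_left (show n' ≤ n - 1 by omega) 2).trans ?_)
      omega
    · exfalso
      rw [heq, hn, Nat.unpair_pair] at hn'
      exact hij hn'.symm
    · refine (min_le_right _ _).trans ?_
      have h3 : (n + 1) * n.factorial ≤ n'.factorial := by
        rw [← Nat.factorial_succ]; exact Nat.factorial_le hgt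
      have h4 : n ^ 2 * n.factorial ^ 2 < n'.factorial ^ 2 := by
        rw [← mul_pow]
        refine Nat.pow_lt_pow_left (lt_of_lt_of_le ?_ h3) two_ne_zero
        exact Nat.mul_lt_mul_of_pos_right (Nat.lt_succ_self n) hfac
      rw [Nat.div_eq_of_lt h4]
      omega
  obtain ⟨p, hp⟩ : ∃ p, n = p + 1 := ⟨n - 1, by omega⟩
  rw [hp, Nat.add_sub_cancel] at h2
  rw [hp] at hMn ⊢
  nlinarith

/-- The dyadic symbols generating an incomparable family. -/
def rampSymbol (j k : ℕ) : ℝ := (6 / 5) ^ (k + rampSup j k)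

theorem isDyadicSymbol_rampSymbol (j : ℕ) : IsDyadicSymbol (rampSymbol j) where
  one_le := one_le_pow₀ (by norm_num)
  zero_le := by
    have h : rampSup j 0 ≤ 1 := rampSup_le_iff.2 fun n _ => ramp_le n 0
    calc rampSymbol j 0 ≤ (6 / 5) ^ 1 := pow_le_pow_right₀ (by norm_num) (by omega)
      _ = 6 / 5 := pow_one _
  le_succ k := by
    rw [rampSymbol, ← pow_succ']
    refine pow_le_pow_right₀ (by norm_num) ?_
    have := rampSup_mono j (Nat.le_succ k)
    simp only [Nat.succ_eq_add_one] at this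
    omega
  succ_le k := by
    rw [show (36 / 25 : ℝ) = (6 / 5) ^ 2 by norm_num, rampSymbol, rampSymbol, ← pow_add]
    refine pow_le_pow_right₀ (by norm_num) ?_
    have := rampSup_succ_le j k
    omega
  add_le k l := by
    rw [rampSymbol, rampSymbol, rampSymbol, ← pow_add]
    refine pow_le_pow_right₀ (by norm_num) ?_
    have := rampSup_add_le j k l
    omega

theorem exists_isIncomparableFamily : ∃ S : ℕ → ℝ → ℝ, IsIncomparableFamily S := by
  refine ⟨fun j => dyadicFun (rampSymbol j),
    fun j => (isDyadicSymbol_rampSymbol j).isSubmultiplicative_dyadicFun, fun A hA j hj M => ?_⟩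
  -- 2^20 · 10 is the distortion between `dyadicFun` and its symbol; a lead of L in the exponent
  -- beats it together with |M|.
  obtain ⟨L, hL⟩ := pow_unbounded_of_one_lt (|M| * (2 ^ 20 * 10)) (show (1 : ℝ) < 6 / 5 by norm_num)
  obtain ⟨k, hk, hlt⟩ := exists_rampSup_add_le j (max L 20)
  refine ⟨2 ^ k, Nat.one_le_two_pow, ?_⟩
  obtain ⟨i, hi, hsup⟩ := Finset.exists_mem_eq_sup' hA
    fun i => dyadicFun (rampSymbol i) ((2 ^ k : ℕ) : ℝ)
  rw [hsup]
  push_cast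
  have hk20 : 20 ≤ k := (le_max_right _ _).trans hk
  have hij : i ≠ j := fun h => hj (h ▸ hi)
  have hi0 := (isDyadicSymbol_rampSymbol i).pos k
  rw [lt_div_iff₀ (hi0.trans_le ((isDyadicSymbol_rampSymbol i).le_dyadicFun_pow hk20))]
  have h1 := (isDyadicSymbol_rampSymbol i).dyadicFun_pow_le k
  have h2 : (6 / 5 : ℝ) ^ L * rampSymbol i k ≤ rampSymbol j k := by
    rw [rampSymbol, rampSymbol, ← pow_add]
    refine pow_le_pow_right₀ (by norm_num) ?_
    have := hlt i hij
    have := le_max_left L 20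
    omega
  have hd0 : 0 ≤ dyadicFun (rampSymbol i) (2 ^ k) :=
    hi0.le.trans ((isDyadicSymbol_rampSymbol i).le_dyadicFun_pow hk20)
  calc M * dyadicFun (rampSymbol i) (2 ^ k)
      ≤ |M| * dyadicFun (rampSymbol i) (2 ^ k) := mul_le_mul_of_nonneg_right (le_abs_self M) hd0
    _ ≤ |M| * (2 ^ 20 * 10 * rampSymbol i k) := mul_le_mul_of_nonneg_left h1 (abs_nonneg M)
    _ = |M| * (2 ^ 20 * 10) * rampSymbol i k := by ring
    _ < (6 / 5) ^ L * rampSymbol i k := mul_lt_mul_of_pos_right hL hi0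
    _ ≤ rampSymbol j k := h2
    _ ≤ _ := (isDyadicSymbol_rampSymbol j).le_dyadicFun_pow hk20

end Exponents

end

theorem theorem2p9 :
    (∃ S : ℕ → ℝ → ℝ, IsIncomparableFamily S) ∧
      ∀ (S : ℕ → ℝ → ℝ) (hS : IsIncomparableFamily S) (n : ℕ),
        Nonempty (SPw (LorentzSum hS.weight n) ≃o {A : Finset (Fin n) // A.Nonempty}) :=
  ⟨exists_isIncomparableFamily, fun _ hS n => hS.nonempty_orderIso n⟩
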